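/- **Setting.** Let $\Lambda\ge 0$, let $n\ge 2$ be even, and let $\mathcal A,\mathcal M,\mathcal B$ be finite-dimensional Hilbert spaces (Alice's workspace, message space, Bob's workspace). An $n$-message $\Lambda$-penalty weak coin-flipping protocol consists of: unit vectors $|\psi_{A,0}\rangle,|\psi_{M,0}\rangle,|\psi_{B,0}\rangle$, with $|\psi_0\rangle=|\psi_{A,0}\rangle|\psi_{M,0}\rangle|\psi_{B,0}\rangle$; unitaries $U_i=U_{A,i}\otimes\mathbb I_{\mathcal B}$ for odd $i$ and $U_i=\mathbb I_{\mathcal A}\otimes U_{B,i}$ for even $i$ ($1\le i\le n$); orthogonal projectors $E_i=E_{A,i}\otimes\mathbb I_{\mathcal B}$ for even $i$ and $E_i=\mathbb I_{\mathcal A}\otimes E_{B,i}$ for odd $i$ ($0\le i\le n-1$) with $E_i|\psi_i\rangle=|\psi_i\rangle$, where $|\psi_i\rangle=U_i\cdots U_1|\psi_0\rangle$; and POVMs $\{\Pi_A^{(0)},\Pi_A^{(1)},\Pi_A^{(\bot)}\}$ on $\mathcal A$ and $\{\Pi_B^{(0)},\Pi_B^{(1)},\Pi_B^{(\bot)}\}$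 on $\mathcal B$. In message $i$ the acting party (Alice for odd $i$, Bob for even $i$) measures $\{E_{i-1},\mathbb I-E_{i-1}\}$ on the incoming state, outputs $\bot$ and stops on the second outcome, and otherwise applies $U_i$ and sends $\mathcal M$ to the other party; after message $n$ both parties output the result of their final POVM. It is required that $(\Pi_A^{(a)}\otimes\mathbb I\otimes\Pi_B^{(b)})|\psi_n\rangle=0$ unless $a=b\in\{0,1\}$, and that this vector has squared norm $\tfrac12$ for $a=b=0$ and for $a=b=1$. **Cheating rewards.** A malicious party has a private memory of arbitrary finite dimension, prepares an arbitrary joint state of message register and memory before message $1$, and applies an arbitrary quantum channel to them in each of its messages (thus a malicious Bob also prepares the register that Alice tests with $E_{A,0}$ in message $1$). Against honest Alice, Bob gets $\Lambda+1$, $\Lambda$, $0$ points when Alice outputs $1$, $0$, $\bot$; against honest Bob, Alice gets $\Lambda+1$, $\Lambda$, $0$ points when Bob outputs $0$, $1$, $\bot$. Let $R_B^*$ (resp. $R_A^*$) be the maximal expected number of points of malicious Bob (resp. Alice) over all strategies. **Theorem.** These maxima are attained, and the following hold. (i) $R_B^*=\inf\ \mathrm{tr}(Z_{A,0}|\psi_{A,0}\rangle\langle\psi_{A,0}|)$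 over all operators $Z_{A,0},\dots,Z_{A,n}$ on $\mathcal A$ such that 1. $Z_{A,i}\ge 0$ for all $i$; 2. for odd $i$, $Z_{A,i-1}\otimes\mathbb I_{\mathcal M}\ge E_{A,i-1}U_{A,i}^\dagger(Z_{A,i}\otimes\mathbb I_{\mathcal M})U_{A,i}E_{A,i-1}$; 3. for even $i\geq 2$, $Z_{A,i-1}=Z_{A,i}$; 4. $Z_{A,n}=\Lambda\,\Pi_A^{(0)}+(\Lambda+1)\,\Pi_A^{(1)}$. Likewise $R_A^*=\inf\ \mathrm{tr}(Z_{B,0}|\psi_{B,0}\rangle\langle\psi_{B,0}|)$ over all operators $Z_{B,0},\dots,Z_{B,n}$ on $\mathcal B$ such that 1. $Z_{B,i}\ge 0$ for all $i$; 2. for even $i\geq 2$, $\mathbb I_{\mathcal M}\otimes Z_{B,i-1}\ge E_{B,i-1}U_{B,i}^\dagger(\mathbb I_{\mathcal M}\otimes Z_{B,i})U_{B,i}E_{B,i-1}$; 3. for odd $i$, $Z_{B,i-1}=Z_{B,i}$; 4. $Z_{B,n}=\Lambda\,\Pi_B^{(1)}+(\Lambda+1)\,\Pi_B^{(0)}$.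 (ii) Call $(Z_{A,i})_i,(Z_{B,i})_i$ a *dual feasible point* if they satisfy these constraints and moreover $Z_{A,0}|\psi_{A,0}\rangle=\beta|\psi_{A,0}\rangle$ and $Z_{B,0}|\psi_{B,0}\rangle=\alpha|\psi_{B,0}\rangle$ with $\beta,\alpha>0$. Then $R_B^*=\inf\beta$ and $R_A^*=\inf\alpha$ over all dual feasible points. (iii) Let $(Z_{A,i})_i$ satisfy the constraints in (i), let $\varepsilon>0$, and write $Z=Z_{A,0}$, $|\psi\rangle=|\psi_{A,0}\rangle$. Then $$Z'=(\langle\psi|Z|\psi\rangle+\varepsilon)\,|\psi\rangle\langle\psi|+\Big(\tfrac{\|Z\|^2}{\varepsilon}+\|Z\|\Big)(\mathbb I-|\psi\rangle\langle\psi|)$$ (with the operator norm) satisfies $Z'\ge Z$ and $Z'|\psi\rangle=(\langle\psi|Z|\psi\rangle+\varepsilon)|\psi\rangle$, and $(Z',Z_{A,1},\dots,Z_{A,n})$ satisfies the constraints again. The same holds for Bob with $Z=Z_{B,0}$, $|\psi\rangle=|\psi_{B,0}\rangle$ and $(Z',Z',Z_{B,2},\dots,Z_{B,n})$. -/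

import Mathlib

open scoped Kronecker Matrix ComplexOrder

noncomputable section

namespace PenWCF

/-- Outcomes of the final measurements: `zero` (Alice wins), `one` (Bob wins) and `abort`
(the symbol `⊥`, cheating detected). -/
inductive Outcome
  | zero
  | one
  | abort
  deriving DecidableEq

instance : Fintype Outcome where
  elems := {Outcome.zero, Outcome.one, Outcome.abort}
  complete := by intro a; cases a <;> decide

/-- `X ⊗ 𝟙_β` for an operator `X` on `α ⊗ μ`, seen on `α ⊗ μ ⊗ β`. -/
def actLeft {α μ : Type*} (β : Type*) [DecidableEq β]
    (X : Matrix (α × μ) (α × μ) ℂ) : Matrix (α × μ × β) (α × μ × β) ℂ :=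
  Matrix.reindex (Equiv.prodAssoc α μ β) (Equiv.prodAssoc α μ β)
    (X ⊗ₖ (1 : Matrix β β ℂ))

/-- `𝟙_α ⊗ Y` for an operator `Y` on `μ ⊗ β`. -/
def actRight (α : Type*) {μ β : Type*} [DecidableEq α]
    (Y : Matrix (μ × β) (μ × β) ℂ) : Matrix (α × μ × β) (α × μ × β) ℂ :=
  (1 : Matrix α α ℂ) ⊗ₖ Y

/-- The operator `|v⟩⟨v|`. -/
def ketbra {ι : Type*} (v : ι → ℂ) : Matrix ι ι ℂ :=
  Matrix.vecMulVec v (star v)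

/-- `tr (Z |v⟩⟨v|) = ⟨v| Z |v⟩`, as a real number (used for Hermitian `Z`). -/
def expect {ι : Type*} [Fintype ι] (Z : Matrix ι ι ℂ) (v : ι → ℂ) : ℝ :=
  (Matrix.trace (Z * ketbra v)).re

/-- The data of an `n`-message protocol. The finite types `𝒜`, `ℳ`, `ℬ` label orthonormal bases
of Alice's workspace, of the message space and of Bob's workspace.
In message `i` (with `1 ≤ i ≤ n`) the acting party (Alice for odd `i`, Bob for even `i`) first
measures `{E_{i-1}, 𝟙 - E_{i-1}}` on the incoming state, aborting on the second outcome, and then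
applies `U_i`. Hence `UA i` is used for odd `i ∈ [1, n]`, `UB i` for even `i ∈ [1, n]`, `EA i` for
even `i ∈ [0, n - 1]` and `EB i` for odd `i ∈ [0, n - 1]`; all other values are irrelevant. -/
structure Scheme (n : ℕ) (𝒜 ℳ ℬ : Type*) where
  ψA : 𝒜 → ℂ
  ψM : ℳ → ℂ
  ψB : ℬ → ℂ
  UA : ℕ → Matrix (𝒜 × ℳ) (𝒜 × ℳ) ℂ
  UB : ℕ → Matrix (ℳ × ℬ) (ℳ × ℬ) ℂ
  EA : ℕ → Matrix (𝒜 × ℳ) (𝒜 × ℳ) ℂ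
  EB : ℕ → Matrix (ℳ × ℬ) (ℳ × ℬ) ℂ
  PiA : Outcome → Matrix 𝒜 𝒜 ℂ
  PiB : Outcome → Matrix ℬ ℬ ℂ

/-- The points of a malicious Bob when honest Alice outputs the given outcome. -/
def bobPoints (Λ : ℝ) : Outcome → ℝ
  | .zero => Λ
  | .one => Λ + 1
  | .abort => 0

/-- The points of a malicious Alice when honest Bob outputs the given outcome. -/
def alicePoints (Λ : ℝ) : Outcome → ℝ
  | .zero => Λ + 1
  | .one => Λ
  | .abort => 0

section
variable {n : ℕ} {𝒜 ℳ ℬ : Type*} [Fintype 𝒜] [DecidableEq 𝒜] [Fintype ℳ] [DecidableEq ℳ]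
  [Fintype ℬ] [DecidableEq ℬ]

/-- The honest states `|ψ_i⟩ = U_i ⋯ U_1 |ψ_0⟩`. -/
def Scheme.honestState (S : Scheme n 𝒜 ℳ ℬ) : ℕ → (𝒜 × ℳ × ℬ → ℂ)
  | 0 => fun x => S.ψA x.1 * S.ψM x.2.1 * S.ψB x.2.2
  | i + 1 => (if Odd (i + 1) then actLeft ℬ (S.UA (i + 1)) else actRight 𝒜 (S.UB (i + 1))) *ᵥ
      S.honestState i

/-- `(Π_A^{(a)} ⊗ 𝟙 ⊗ Π_B^{(b)}) |ψ_n⟩`. -/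
def Scheme.finalBranch (S : Scheme n 𝒜 ℳ ℬ) (a b : Outcome) : 𝒜 × ℳ × ℬ → ℂ :=
  (S.PiA a ⊗ₖ ((1 : Matrix ℳ ℳ ℂ) ⊗ₖ S.PiB b)) *ᵥ S.honestState n

end

/-- An `n`-message weak coin-flipping protocol with outcomes `0`, `1`, `⊥`. -/
structure Protocol (n : ℕ) (𝒜 ℳ ℬ : Type*) [Fintype 𝒜] [DecidableEq 𝒜] [Fintype ℳ]
    [DecidableEq ℳ] [Fintype ℬ] [DecidableEq ℬ] extends Scheme n 𝒜 ℳ ℬ where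
  n_pos : 0 < n
  n_even : Even n
  norm_ψA : star ψA ⬝ᵥ ψA = 1
  norm_ψM : star ψM ⬝ᵥ ψM = 1
  norm_ψB : star ψB ⬝ᵥ ψB = 1
  unitaryA : ∀ i, 1 ≤ i → i ≤ n → Odd i → UA i ∈ Matrix.unitaryGroup (𝒜 × ℳ) ℂ
  unitaryB : ∀ i, 1 ≤ i → i ≤ n → Even i → UB i ∈ Matrix.unitaryGroup (ℳ × ℬ) ℂ
  projA : ∀ i, i < n → Even i → IsStarProjection (EA i)
  projB : ∀ i, i < n → Odd i → IsStarProjection (EB i)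
  /-- `E_i |ψ_i⟩ = |ψ_i⟩`: the honest run passes every intermediate test. -/
  passA : ∀ i, i < n → Even i →
    actLeft ℬ (EA i) *ᵥ toScheme.honestState i = toScheme.honestState i
  passB : ∀ i, i < n → Odd i →
    actRight 𝒜 (EB i) *ᵥ toScheme.honestState i = toScheme.honestState i
  povmA_nonneg : ∀ a, (PiA a).PosSemidef
  povmA_sum : ∑ a, PiA a = 1
  povmB_nonneg : ∀ b, (PiB b).PosSemidef
  povmB_sum : ∑ b, PiB b = 1
  /-- Correctness: the honest parties never abort and never disagree. -/
  correct : ∀ a b, ¬ (a = b ∧ a ≠ Outcome.abort) → toScheme.finalBranch a b = 0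
  /-- Balancedness: either party wins the honest run with probability `1/2`. -/
  balanced_zero :
    star (toScheme.finalBranch .zero .zero) ⬝ᵥ toScheme.finalBranch .zero .zero = 1 / 2
  balanced_one :
    star (toScheme.finalBranch .one .one) ⬝ᵥ toScheme.finalBranch .one .one = 1 / 2

/-- A cheating strategy with a private memory of an arbitrary finite dimension `d`, on the space
labelled by `κ` (message together with memory): an arbitrary initial density operator, and in every
message of the cheating party an arbitrary quantum channel, given by Kraus operators. -/
structure Strategy (κ : Type*) [Fintype κ] [DecidableEq κ] where
  init : Matrix κ κ ℂ
  init_nonneg : init.PosSemidef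
  init_trace : init.trace = 1
  /-- The number of Kraus operators. -/
  r : ℕ
  kraus : ℕ → Fin r → Matrix κ κ ℂ
  kraus_complete : ∀ i, ∑ k, (kraus i k)ᴴ * kraus i k = 1

section
variable {n : ℕ} {𝒜 ℳ ℬ : Type*} [Fintype 𝒜] [DecidableEq 𝒜] [Fintype ℳ] [DecidableEq ℳ]
  [Fintype ℬ] [DecidableEq ℬ]

/-- The (unnormalised) joint state after message `i` of honest Alice and malicious Bob, on the
event that Alice has not aborted. Its trace is the probability of that event.
The register handed to Alice before message `1` is prepared by Bob. -/
def Scheme.stateVsBob (S : Scheme n 𝒜 ℳ ℬ) {d : ℕ} (T : Strategy (ℳ × Fin d)) :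
    ℕ → Matrix (𝒜 × ℳ × Fin d) (𝒜 × ℳ × Fin d) ℂ
  | 0 => ketbra S.ψA ⊗ₖ T.init
  | i + 1 =>
    if Odd (i + 1) then
      actLeft (Fin d) (S.UA (i + 1) * S.EA i) * S.stateVsBob T i *
        (actLeft (Fin d) (S.UA (i + 1) * S.EA i))ᴴ
    else
      ∑ k, actRight 𝒜 (T.kraus (i + 1) k) * S.stateVsBob T i * (actRight 𝒜 (T.kraus (i + 1) k))ᴴ

/-- The (unnormalised) joint state after message `i` of malicious Alice and honest Bob, on the
event that Bob has not aborted. -/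
def Scheme.stateVsAlice (S : Scheme n 𝒜 ℳ ℬ) {d : ℕ} (T : Strategy (Fin d × ℳ)) :
    ℕ → Matrix (Fin d × ℳ × ℬ) (Fin d × ℳ × ℬ) ℂ
  | 0 => Matrix.reindex (Equiv.prodAssoc (Fin d) ℳ ℬ) (Equiv.prodAssoc (Fin d) ℳ ℬ)
      (T.init ⊗ₖ ketbra S.ψB)
  | i + 1 =>
    if Odd (i + 1) then
      ∑ k, actLeft ℬ (T.kraus (i + 1) k) * S.stateVsAlice T i * (actLeft ℬ (T.kraus (i + 1) k))ᴴ
    else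
      actRight (Fin d) (S.UB (i + 1) * S.EB i) * S.stateVsAlice T i *
        (actRight (Fin d) (S.UB (i + 1) * S.EB i))ᴴ

/-- Expected number of points of malicious Bob; an abort during the protocol is worth `0` points
and hence does not contribute. -/
def Scheme.bobReward (S : Scheme n 𝒜 ℳ ℬ) (Λ : ℝ) {d : ℕ} (T : Strategy (ℳ × Fin d)) : ℝ :=
  ∑ a, bobPoints Λ a *
    (Matrix.trace ((S.PiA a ⊗ₖ (1 : Matrix (ℳ × Fin d) (ℳ × Fin d) ℂ)) * S.stateVsBob T n)).re

/-- Expected number of points of malicious Alice. -/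
def Scheme.aliceReward (S : Scheme n 𝒜 ℳ ℬ) (Λ : ℝ) {d : ℕ} (T : Strategy (Fin d × ℳ)) : ℝ :=
  ∑ b, alicePoints Λ b *
    (Matrix.trace (((1 : Matrix (Fin d) (Fin d) ℂ) ⊗ₖ ((1 : Matrix ℳ ℳ ℂ) ⊗ₖ S.PiB b)) *
      S.stateVsAlice T n)).re

/-- The rewards that malicious Bob can reach against honest Alice. -/
def Scheme.bobRewards (S : Scheme n 𝒜 ℳ ℬ) (Λ : ℝ) : Set ℝ :=
  {x | ∃ (d : ℕ) (T : Strategy (ℳ × Fin d)), x = S.bobReward Λ T}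

/-- The rewards that malicious Alice can reach against honest Bob. -/
def Scheme.aliceRewards (S : Scheme n 𝒜 ℳ ℬ) (Λ : ℝ) : Set ℝ :=
  {x | ∃ (d : ℕ) (T : Strategy (Fin d × ℳ)), x = S.aliceReward Λ T}

/-- Bob's cheating reward `R_B^*`. -/
def Scheme.RB (S : Scheme n 𝒜 ℳ ℬ) (Λ : ℝ) : ℝ := sSup (S.bobRewards Λ)

/-- Alice's cheating reward `R_A^*`. -/
def Scheme.RA (S : Scheme n 𝒜 ℳ ℬ) (Λ : ℝ) : ℝ := sSup (S.aliceRewards Λ)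

/-- The constraints of the dual program for `R_B^*` on `Z_{A,0}, …, Z_{A,n}`. -/
structure Scheme.DualA (S : Scheme n 𝒜 ℳ ℬ) (Λ : ℝ) (Z : ℕ → Matrix 𝒜 𝒜 ℂ) : Prop where
  nonneg : ∀ i, i ≤ n → (Z i).PosSemidef
  step : ∀ i, i < n → Odd (i + 1) →
    (Z i ⊗ₖ (1 : Matrix ℳ ℳ ℂ) -
      S.EA i * (S.UA (i + 1))ᴴ * (Z (i + 1) ⊗ₖ (1 : Matrix ℳ ℳ ℂ)) * S.UA (i + 1) *
        S.EA i).PosSemidef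
  keep : ∀ i, i < n → Even (i + 1) → Z i = Z (i + 1)
  terminal : Z n = (Λ : ℂ) • S.PiA .zero + ((Λ + 1 : ℝ) : ℂ) • S.PiA .one

/-- The constraints of the dual program for `R_A^*` on `Z_{B,0}, …, Z_{B,n}`. -/
structure Scheme.DualB (S : Scheme n 𝒜 ℳ ℬ) (Λ : ℝ) (Z : ℕ → Matrix ℬ ℬ ℂ) : Prop where
  nonneg : ∀ i, i ≤ n → (Z i).PosSemidef
  step : ∀ i, i < n → Even (i + 1) →
    ((1 : Matrix ℳ ℳ ℂ) ⊗ₖ Z i -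
      S.EB i * (S.UB (i + 1))ᴴ * ((1 : Matrix ℳ ℳ ℂ) ⊗ₖ Z (i + 1)) * S.UB (i + 1) *
        S.EB i).PosSemidef
  keep : ∀ i, i < n → Odd (i + 1) → Z i = Z (i + 1)
  terminal : Z n = (Λ : ℂ) • S.PiB .one + ((Λ + 1 : ℝ) : ℂ) • S.PiB .zero

/-- Dual feasible points: all dual constraints hold, and the initial local states are eigenvectors
of `Z_{A,0}` and `Z_{B,0}` with eigenvalues `β > 0` and `α > 0`. -/
structure Scheme.DualFeasiblePoint (S : Scheme n 𝒜 ℳ ℬ) (Λ : ℝ) (ZA : ℕ → Matrix 𝒜 𝒜 ℂ)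
    (ZB : ℕ → Matrix ℬ ℬ ℂ) (β α : ℝ) : Prop where
  dualA : S.DualA Λ ZA
  dualB : S.DualB Λ ZB
  β_pos : 0 < β
  α_pos : 0 < α
  eigA : ZA 0 *ᵥ S.ψA = (β : ℂ) • S.ψA
  eigB : ZB 0 *ᵥ S.ψB = (α : ℂ) • S.ψB

end

/-- The operator norm with respect to the Euclidean (Hilbert space) norm. -/
def opNorm {ι : Type*} [Fintype ι] [DecidableEq ι] (Z : Matrix ι ι ℂ) : ℝ :=
  ‖Matrix.toEuclideanCLM (n := ι) (𝕜 := ℂ) Z‖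

/-- `(⟨ψ|Z|ψ⟩ + ε) |ψ⟩⟨ψ| + v (𝟙 - |ψ⟩⟨ψ|)` with `v = ‖Z‖² / ε + ‖Z‖`. -/
def perturb {ι : Type*} [Fintype ι] [DecidableEq ι] (Z : Matrix ι ι ℂ) (ψ : ι → ℂ) (ε : ℝ) :
    Matrix ι ι ℂ :=
  ((expect Z ψ + ε : ℝ) : ℂ) • ketbra ψ +
    ((opNorm Z ^ 2 / ε + opNorm Z : ℝ) : ℂ) • (1 - ketbra ψ)

end PenWCF

end

/-! ### Conic duality in finite dimension -/

section ConicDuality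

open Filter Topology Set

/-! A cheater influences the honest party only through the reduced states on workspace and message,
and no channel on message and memory changes the workspace marginal. Hence every strategy yields a
chain of positive operators with prescribed consecutive marginals (`IsChain`). Conversely, purify
all members of a chain with one common memory: equal workspace marginals mean that the purifications
differ by a unitary on message and memory, and the cheater can apply it
(`IsChain.exists_realization`). The reward is thus the value of a semidefinite program over chains,
with `k = n / 2` honest actions.

Its dual is handled by conic duality (`conic_strong_duality`). No Slater condition is needed: a
positive operator with zero partial trace vanishes, so the constraint map kills no nonzero point of
the cone (`eq_zero_of_chainMap_eq_zero`). This makes the feasible set compact and the relevant image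
cone closed, so the maximum is attained and a separating functional closes the gap.
`isDualChain_of_functional` turns the functional into dual operators. The case of malicious Alice is
reduced to the same program by reversing the tensor factors.

For the eigenvalue form, raising `Z 0` preserves its constraint, and `posSemidef_perturb_sub` raises
it to an operator with the initial state as eigenvector, at a cost of `ε` in the objective. -/

/-- A linear map that is injective at `0` on a closed cone is bounded below on the cone. -/
theorem exists_pos_mul_norm_le_of_cone {E F : Type*} [NormedAddCommGroup E] [NormedSpace ℝ E]
    [FiniteDimensional ℝ E] [NormedAddCommGroup F] [NormedSpace ℝ F] {C : Set E}
    (hC : IsClosed C) (hsmul : ∀ x ∈ C, ∀ t : ℝ, 0 ≤ t → t • x ∈ C) (L : E →ₗ[ℝ] F)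
    (hker : ∀ x ∈ C, L x = 0 → x = 0) : ∃ m : ℝ, 0 < m ∧ ∀ x ∈ C, m * ‖x‖ ≤ ‖L x‖ := by
  have hcont : Continuous L := L.continuous_of_finiteDimensional
  have hcomp : IsCompact (C ∩ Metric.sphere (0 : E) 1) := (isCompact_sphere 0 1).inter_left hC
  rcases (C ∩ Metric.sphere (0 : E) 1).eq_empty_or_nonempty with hemp | hne
  · refine ⟨1, one_pos, fun x hx => ?_⟩
    by_cases h0 : x = 0
    · simp [h0]
    · exfalso
      have : ‖x‖⁻¹ • x ∈ C ∩ Metric.sphere (0 : E) 1 :=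
        ⟨hsmul x hx _ (by positivity), by simp [norm_smul, h0]⟩
      simp [hemp] at this
  · obtain ⟨y, hy, hmin⟩ := hcomp.exists_isMinOn hne hcont.norm.continuousOn
    have hy1 : ‖y‖ = 1 := by simpa using hy.2
    refine ⟨‖L y‖, norm_pos_iff.2 fun h => ?_, fun x hx => ?_⟩
    · simp [hker y hy.1 h] at hy1
    · by_cases h0 : x = 0
      · simp [h0]
      · have hx1 : ‖x‖⁻¹ • x ∈ C ∩ Metric.sphere (0 : E) 1 :=
          ⟨hsmul x hx _ (by positivity), by simp [norm_smul, h0]⟩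
        have h := hmin hx1
        simp only [mem_ofPred_eq, map_smul, norm_smul, norm_inv, norm_norm] at h
        have hp : 0 < ‖x‖ := norm_pos_iff.2 h0
        rwa [inv_mul_eq_div, le_div_iff₀ hp] at h

/-- The image of a closed cone under a linear map that is injective at `0` on it is closed. -/
theorem isClosed_image_of_cone {E F : Type*} [NormedAddCommGroup E] [NormedSpace ℝ E]
    [FiniteDimensional ℝ E] [NormedAddCommGroup F] [NormedSpace ℝ F] {C : Set E}
    (hC : IsClosed C) (hsmul : ∀ x ∈ C, ∀ t : ℝ, 0 ≤ t → t • x ∈ C) (L : E →ₗ[ℝ] F)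
    (hker : ∀ x ∈ C, L x = 0 → x = 0) : IsClosed (L '' C) := by
  obtain ⟨m, hm, hle⟩ := exists_pos_mul_norm_le_of_cone hC hsmul L hker
  have hcont : Continuous L := L.continuous_of_finiteDimensional
  refine isClosed_of_closure_subset fun y hy => ?_
  -- Preimages in `C` of points within distance `1` of `y` have norm at most `(‖y‖ + 1) / m`, so
  -- near `y` the image is contained in a compact part of itself.
  have hK : IsCompact (L '' (C ∩ Metric.closedBall 0 ((‖y‖ + 1) / m))) :=
    ((isCompact_closedBall 0 _).inter_left hC).image hcont
  have hy' : y ∈ closure (L '' C ∩ Metric.ball y 1) :=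
    mem_closure_iff_nhds.2 fun t ht => by
      obtain ⟨z, hz, hzC⟩ :=
        mem_closure_iff_nhds.1 hy _ (inter_mem ht (Metric.ball_mem_nhds y one_pos))
      exact ⟨z, hz.1, hzC, hz.2⟩
  have hsub : L '' C ∩ Metric.ball y 1 ⊆ L '' (C ∩ Metric.closedBall 0 ((‖y‖ + 1) / m)) := by
    rintro _ ⟨⟨x, hx, rfl⟩, hb⟩
    refine ⟨x, ⟨hx, ?_⟩, rfl⟩
    rw [mem_closedBall_zero_iff, le_div_iff₀ hm, mul_comm]
    have h1 : ‖L x - y‖ < 1 := by rwa [← dist_eq_norm]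
    have h2 := norm_le_norm_add_norm_sub' (L x) y
    linarith [hle x hx]
  exact image_mono inter_subset_left (closure_minimal hsub hK.isClosed hy')

/-- Strong duality for a conic program whose cone contains no nonzero point of the kernel of the
constraint map: the primal optimum is attained and there is no duality gap. -/
theorem conic_strong_duality {E F : Type*} [NormedAddCommGroup E] [NormedSpace ℝ E]
    [FiniteDimensional ℝ E] [NormedAddCommGroup F] [NormedSpace ℝ F] {C : Set E}
    (hC : IsClosed C) (hsmul : ∀ x ∈ C, ∀ t : ℝ, 0 ≤ t → t • x ∈ C)
    (hadd : ∀ x ∈ C, ∀ y ∈ C, x + y ∈ C) (L : E →ₗ[ℝ] F) (c : E →ₗ[ℝ] ℝ)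
    (hker : ∀ x ∈ C, L x = 0 → x = 0) (b : F) (hb : ∃ x ∈ C, L x = b) :
    ∃ s ∈ C, L s = b ∧ ∀ v, c s < v → ∃ f : F →ₗ[ℝ] ℝ, (∀ x ∈ C, c x ≤ f (L x)) ∧ f b < v := by
  obtain ⟨m, hm, hle⟩ := exists_pos_mul_norm_le_of_cone hC hsmul L hker
  have hLc : Continuous L := L.continuous_of_finiteDimensional
  have hcc : Continuous c := c.continuous_of_finiteDimensional
  have hcomp : IsCompact (C ∩ L ⁻¹' {b}) := by
    refine (isCompact_closedBall (0 : E) (‖b‖ / m)).of_isClosed_subset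
      (hC.inter (isClosed_singleton.preimage hLc)) ?_
    rintro x ⟨hx, hxb⟩
    rw [mem_closedBall_zero_iff, le_div_iff₀ hm, mul_comm]
    simpa [show L x = b from hxb] using hle x hx
  obtain ⟨x₀, hx₀, hx₀b⟩ := hb
  obtain ⟨s, ⟨hsC, hsb⟩, hmax⟩ := hcomp.exists_isMaxOn ⟨x₀, hx₀, hx₀b⟩ hcc.continuousOn
  refine ⟨s, hsC, hsb, fun v hv => ?_⟩
  -- The slack `r ≥ 0` turns the attainable pairs into the hypograph cone of points `(L x, c x -
  -- r)`. On `D` the map `N` still kills only `0`, so this cone is closed and can be separated from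
  -- `(b, v)`.
  set D : Set (E × ℝ) := C ×ˢ Ici 0
  let N : E × ℝ →ₗ[ℝ] F × ℝ :=
    (L ∘ₗ LinearMap.fst ℝ E ℝ).prod (c ∘ₗ LinearMap.fst ℝ E ℝ - LinearMap.snd ℝ E ℝ)
  have hN : ∀ x r, N (x, r) = (L x, c x - r) := fun x r => rfl
  have hDsmul : ∀ p ∈ D, ∀ t : ℝ, 0 ≤ t → t • p ∈ D := fun p hp t ht =>
    ⟨hsmul _ hp.1 t ht, mem_Ici.2 (mul_nonneg ht hp.2)⟩
  have hclosed : IsClosed (N '' D) := by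
    refine isClosed_image_of_cone (hC.prod isClosed_Ici) hDsmul N ?_
    rintro ⟨x, r⟩ ⟨hx, hr⟩ h
    rw [hN, Prod.mk_eq_zero] at h
    have hx0 := hker x hx h.1
    subst hx0
    have : r = 0 := by simpa using h.2
    simp [this]
  have hconv : Convex ℝ (N '' D) := by
    refine Convex.linear_image (fun p hp q hq a b ha hb _ => ?_) N
    exact ⟨hadd _ (hDsmul p hp a ha).1 _ (hDsmul q hq b hb).1,
      mem_Ici.2 (add_nonneg (hDsmul p hp a ha).2 (hDsmul q hq b hb).2)⟩
  have hnot : ((b, v) : F × ℝ) ∉ N '' D := by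
    rintro ⟨⟨x, r⟩, ⟨hx, hr⟩, h⟩
    rw [hN, Prod.mk.injEq] at h
    have h1 : c x ≤ c s := hmax ⟨hx, h.1⟩
    have h2 : (0 : ℝ) ≤ r := hr
    linarith [h.2]
  obtain ⟨g, u, hg, hu⟩ := geometric_hahn_banach_closed_point hconv hclosed hnot
  have h0C : (0 : E) ∈ C := by simpa using hsmul s hsC 0 le_rfl
  have hu0 : 0 < u := by
    have h := hg (N 0) ⟨0, ⟨h0C, mem_Ici.2 le_rfl⟩, rfl⟩
    rwa [map_zero, map_zero] at h
  -- A functional bounded above on a cone is nonpositive there: a positive value could be rescaled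
  -- to equal the bound `u`.
  have hcone : ∀ p ∈ D, g (N p) ≤ 0 := by
    intro p hp
    by_contra! hpos
    have h := hg (N ((u / g (N p)) • p)) ⟨_, hDsmul p hp _ (by positivity), rfl⟩
    rw [map_smul, map_smul, smul_eq_mul, div_mul_cancel₀ _ hpos.ne'] at h
    exact lt_irrefl _ h
  have hsplit : ∀ y t, g (y, t) = g (y, 0) + t * g (0, 1) := fun y t => by
    rw [← smul_eq_mul, ← map_smul, ← map_add]; simp
  have hμ0 : 0 ≤ g (0, 1) := by
    have h := hcone (0, 1) ⟨h0C, mem_Ici.2 zero_le_one⟩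
    rw [hN, hsplit] at h
    have h2 : g ((0 : F), (0 : ℝ)) = 0 := map_zero g
    simp only [map_zero, h2] at h
    linarith
  have hfeas : g (b, 0) + c s * g (0, 1) ≤ 0 := by
    have h := hcone (s, 0) ⟨hsC, mem_Ici.2 le_rfl⟩
    rwa [hN, hsplit, show L s = b from hsb, sub_zero] at h
  have hbv : 0 < g (b, 0) + v * g (0, 1) := by
    rw [← hsplit]; exact hu0.trans hu
  -- The separating hyperplane is not vertical: otherwise the feasible point `s` and `(b, v)` would
  -- give contradictory signs of `g (b, 0)`. Dividing by `g (0, 1)` yields the dual functional.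
  have hμ : 0 < g (0, 1) := by
    rcases hμ0.lt_or_eq with h | h
    · exact h
    · rw [← h] at hfeas hbv; linarith
  refine ⟨-((g (0, 1))⁻¹ • ((g : F × ℝ →ₗ[ℝ] ℝ) ∘ₗ LinearMap.inl ℝ F ℝ)), fun x hx => ?_, ?_⟩
  · have h := hcone (x, 0) ⟨hx, mem_Ici.2 le_rfl⟩
    rw [hN, hsplit, sub_zero] at h
    simp only [LinearMap.neg_apply, LinearMap.smul_apply, LinearMap.comp_apply, LinearMap.inl_apply,
      smul_eq_mul, ContinuousLinearMap.coe_coe]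
    rw [← mul_neg, inv_mul_eq_div, le_div_iff₀ hμ]
    linarith
  · simp only [LinearMap.neg_apply, LinearMap.smul_apply, LinearMap.comp_apply, LinearMap.inl_apply,
      smul_eq_mul, ContinuousLinearMap.coe_coe]
    rw [← mul_neg, inv_mul_eq_div, div_lt_iff₀ hμ]
    linarith

end ConicDuality

noncomputable section

namespace PenWCF

set_option linter.unusedSectionVars false

/-! ### Partial traces -/

section PartialTrace

variable {α κ μ δ : Type*} [Fintype α] [DecidableEq α] [Fintype κ] [DecidableEq κ] [Fintype μ]
  [DecidableEq μ] [Fintype δ] [DecidableEq δ]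

/-- The partial trace over the right tensor factor. -/
def leftMarginal {α κ : Type*} [Fintype κ] : Matrix (α × κ) (α × κ) ℂ →ₗ[ℂ] Matrix α α ℂ where
  toFun s := Matrix.of fun a a' => ∑ m, s (a, m) (a', m)
  map_add' s t := by ext; simp [Finset.sum_add_distrib]
  map_smul' c s := by ext; simp [Finset.mul_sum]

theorem leftMarginal_apply (s : Matrix (α × κ) (α × κ) ℂ) (a a' : α) :
    leftMarginal s a a' = ∑ m, s (a, m) (a', m) := rfl

theorem leftMarginal_eq_sum (s : Matrix (α × κ) (α × κ) ℂ) :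
    leftMarginal s = ∑ m, s.submatrix (fun a => (a, m)) fun a => (a, m) := by
  ext a a'
  simp [leftMarginal_apply, Matrix.sum_apply]

theorem posSemidef_leftMarginal {s : Matrix (α × κ) (α × κ) ℂ} (hs : s.PosSemidef) :
    (leftMarginal s).PosSemidef := by
  rw [leftMarginal_eq_sum]
  exact Matrix.posSemidef_sum _ fun m _ => hs.submatrix _

theorem trace_leftMarginal (s : Matrix (α × κ) (α × κ) ℂ) :
    (leftMarginal s).trace = s.trace := by
  simp [Matrix.trace, leftMarginal_apply, Fintype.sum_prod_type]

/-- The partial trace is the adjoint of `Z ↦ Z ⊗ₖ 1` for the trace pairing. Identities between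
marginals are then proved by testing against every `Z`. -/
theorem trace_kronecker_one_mul (Z : Matrix α α ℂ) (s : Matrix (α × κ) (α × κ) ℂ) :
    ((Z ⊗ₖ (1 : Matrix κ κ ℂ)) * s).trace = (Z * leftMarginal s).trace := by
  simp only [Matrix.trace, Matrix.diag, Matrix.mul_apply, leftMarginal_apply,
    Fintype.sum_prod_type, Matrix.kroneckerMap_apply, Matrix.one_apply, mul_ite, mul_one, mul_zero,
    ite_mul, zero_mul, Finset.sum_ite_eq, Finset.mem_univ, if_true, Finset.mul_sum]
  refine Finset.sum_congr rfl fun a _ => ?_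
  rw [Finset.sum_comm]

theorem leftMarginal_kronecker (ρ : Matrix α α ℂ) (σ : Matrix κ κ ℂ) :
    leftMarginal (ρ ⊗ₖ σ) = σ.trace • ρ := by
  ext a a'
  simp [leftMarginal_apply, Matrix.trace, Finset.mul_sum, mul_comm]

theorem leftMarginal_kronecker_conj (X : Matrix α α ℂ) (s : Matrix (α × κ) (α × κ) ℂ) :
    leftMarginal ((X ⊗ₖ (1 : Matrix κ κ ℂ)) * s * (X ⊗ₖ (1 : Matrix κ κ ℂ))ᴴ) =
      X * leftMarginal s * Xᴴ := by
  refine Matrix.ext_iff_trace_mul_left.2 fun Z => ?_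
  rw [← trace_kronecker_one_mul, ← mul_assoc, ← mul_assoc, Matrix.trace_mul_comm, ← mul_assoc,
    ← mul_assoc, Matrix.conjTranspose_kronecker, Matrix.conjTranspose_one,
    ← Matrix.mul_kronecker_mul, ← Matrix.mul_kronecker_mul, mul_one, mul_one,
    trace_kronecker_one_mul, ← mul_assoc, ← mul_assoc, Matrix.trace_mul_comm (Z * X * _),
    ← mul_assoc, ← mul_assoc]

/-- A channel on the right tensor factor does not change the left marginal. -/
theorem leftMarginal_channel {ι : Type*} [Fintype ι] (K : ι → Matrix κ κ ℂ)
    (hK : ∑ k, (K k)ᴴ * K k = 1) (s : Matrix (α × κ) (α × κ) ℂ) :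
    leftMarginal (∑ k, ((1 : Matrix α α ℂ) ⊗ₖ K k) * s * ((1 : Matrix α α ℂ) ⊗ₖ K k)ᴴ) =
      leftMarginal s := by
  refine Matrix.ext_iff_trace_mul_left.2 fun Z => ?_
  rw [← trace_kronecker_one_mul, ← trace_kronecker_one_mul, Finset.mul_sum, Matrix.trace_sum]
  have h : ∀ k, ((Z ⊗ₖ (1 : Matrix κ κ ℂ)) *
      (((1 : Matrix α α ℂ) ⊗ₖ K k) * s * ((1 : Matrix α α ℂ) ⊗ₖ K k)ᴴ)).trace =
      ((Z ⊗ₖ ((K k)ᴴ * K k)) * s).trace := fun k => by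
    rw [← mul_assoc, ← mul_assoc, Matrix.trace_mul_comm, ← mul_assoc, ← mul_assoc,
      Matrix.conjTranspose_kronecker, Matrix.conjTranspose_one, ← Matrix.mul_kronecker_mul,
      ← Matrix.mul_kronecker_mul, mul_one, one_mul, mul_one]
  simp_rw [h]
  rw [← Matrix.trace_sum, ← Finset.sum_mul, ← hK]
  congr 2
  ext ⟨a, m⟩ ⟨a', m'⟩
  simp [Matrix.sum_apply, Finset.mul_sum]

/-- The marginal on the first two of three tensor factors. -/
def dropRight {α μ δ : Type*} [Fintype δ] (s : Matrix (α × μ × δ) (α × μ × δ) ℂ) :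
    Matrix (α × μ) (α × μ) ℂ :=
  leftMarginal (s.submatrix (Equiv.prodAssoc α μ δ) (Equiv.prodAssoc α μ δ))

theorem leftMarginal_dropRight (s : Matrix (α × μ × δ) (α × μ × δ) ℂ) :
    leftMarginal (dropRight s) = leftMarginal s := by
  ext a a'
  simp [dropRight, leftMarginal_apply, Fintype.sum_prod_type]

theorem posSemidef_dropRight {s : Matrix (α × μ × δ) (α × μ × δ) ℂ} (hs : s.PosSemidef) :
    (dropRight s).PosSemidef :=
  posSemidef_leftMarginal (hs.submatrix _)

theorem dropRight_conj (X : Matrix (α × μ) (α × μ) ℂ) (s : Matrix (α × μ × δ) (α × μ × δ) ℂ) :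
    dropRight (actLeft δ X * s * (actLeft δ X)ᴴ) = X * dropRight s * Xᴴ := by
  rw [dropRight, ← Matrix.submatrix_mul_equiv _ _ _ (Equiv.prodAssoc α μ δ),
    ← Matrix.submatrix_mul_equiv _ _ _ (Equiv.prodAssoc α μ δ), ← Matrix.conjTranspose_submatrix,
    actLeft, Matrix.reindex_apply, Matrix.submatrix_submatrix, Equiv.symm_comp_self,
    Matrix.submatrix_id_id, leftMarginal_kronecker_conj]
  rfl

theorem ketbra_mulVec (X : Matrix α α ℂ) (v : α → ℂ) :
    ketbra (X *ᵥ v) = X * ketbra v * Xᴴ := by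
  rw [ketbra, ketbra, Matrix.mul_vecMulVec, Matrix.vecMulVec_mul, Matrix.star_mulVec]

theorem posSemidef_ketbra (v : α → ℂ) : (ketbra v).PosSemidef :=
  Matrix.posSemidef_vecMulVec_self_star v

theorem trace_mul_ketbra (Z : Matrix α α ℂ) (v : α → ℂ) :
    (Z * ketbra v).trace = star v ⬝ᵥ (Z *ᵥ v) := by
  rw [ketbra, Matrix.mul_vecMulVec, Matrix.trace_vecMulVec, dotProduct_comm]

theorem trace_ketbra (v : α → ℂ) : (ketbra v).trace = star v ⬝ᵥ v := by
  rw [ketbra, Matrix.trace_vecMulVec, dotProduct_comm]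

theorem ketbra_product {α κ : Type*} (ψ : α → ℂ) (η : κ → ℂ) :
    ketbra (fun x : α × κ => ψ x.1 * η x.2) = ketbra ψ ⊗ₖ ketbra η := by
  ext x y
  simp [ketbra, Matrix.vecMulVec_apply]
  ring

end PartialTrace

/-! ### Self-duality of the positive cone and representation of functionals -/

section Positivity

variable {α κ : Type*} [Fintype α] [DecidableEq α] [Fintype κ] [DecidableEq κ]

theorem exists_eq_mul_conjTranspose {s : Matrix α α ℂ} (hs : s.PosSemidef) :
    ∃ R : Matrix α α ℂ, s = R * Rᴴ := by
  open scoped MatrixOrder in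
  obtain ⟨B, hB⟩ := CStarAlgebra.nonneg_iff_eq_star_mul_self.mp hs.nonneg
  exact ⟨Bᴴ, by simpa [Matrix.star_eq_conjTranspose] using hB⟩

theorem re_trace_mul_nonneg {X s : Matrix α α ℂ} (hX : X.PosSemidef) (hs : s.PosSemidef) :
    0 ≤ (X * s).trace.re := by
  obtain ⟨R, rfl⟩ := exists_eq_mul_conjTranspose hs
  rw [← mul_assoc, Matrix.trace_mul_comm, ← mul_assoc]
  exact (Complex.nonneg_iff.1 (hX.conjTranspose_mul_mul_same R).trace_nonneg).1

theorem posSemidef_of_re_trace_nonneg {X : Matrix α α ℂ} (hX : X.IsHermitian)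
    (h : ∀ s : Matrix α α ℂ, s.PosSemidef → 0 ≤ (X * s).trace.re) : X.PosSemidef := by
  refine .of_dotProduct_mulVec_nonneg hX fun v => ?_
  rw [Complex.nonneg_iff]
  refine ⟨?_, (hX.im_star_dotProduct_mulVec_self v).symm⟩
  rw [← trace_mul_ketbra]
  exact h _ (posSemidef_ketbra v)

theorem posSemidef_of_kronecker_one [Nonempty κ] {Z : Matrix α α ℂ}
    (h : (Z ⊗ₖ (1 : Matrix κ κ ℂ)).PosSemidef) : Z.PosSemidef := by
  obtain ⟨m⟩ := ‹Nonempty κ›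
  have := h.submatrix fun a : α => (a, m)
  convert this using 1
  ext a a'
  simp

/-- A real functional on matrices is, on Hermitian matrices, given by a Hermitian matrix. -/
theorem exists_hermitian_of_functional (f : Matrix α α ℂ →ₗ[ℝ] ℝ) :
    ∃ Z : Matrix α α ℂ, Z.IsHermitian ∧
      ∀ X : Matrix α α ℂ, X.IsHermitian → f X = (Z * X).trace.re := by
  -- `f` is only real linear, so its values on `E_ab` and `i E_ab` are independent data. They are
  -- the real part and minus the imaginary part of the entry, because `Re ((p - iq)(x + iy)) = px +
  -- qy`.
  let Y : Matrix α α ℂ := Matrix.of fun b a =>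
    ((f (Matrix.single a b 1) : ℝ) : ℂ) - Complex.I * ((f (Matrix.single a b Complex.I) : ℝ) : ℂ)
  have hY : ∀ X, f X = (Y * X).trace.re := by
    intro X
    conv_lhs => rw [Matrix.matrix_eq_sum_single X]
    have h1 : ∀ a b, f (Matrix.single a b (X a b)) = (Y b a * X a b).re := by
      intro a b
      have : Matrix.single a b (X a b) = (X a b).re • Matrix.single a b (1 : ℂ) +
          (X a b).im • Matrix.single a b Complex.I := by
        rw [Matrix.smul_single, Matrix.smul_single, ← Matrix.single_add]
        congr 1
        simp [Complex.re_add_im]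
      rw [this, map_add, map_smul, map_smul]
      simp [Y]
      ring
    simp only [map_sum, h1, Matrix.trace, Matrix.diag, Matrix.mul_apply, Complex.re_sum]
    rw [Finset.sum_comm]
  refine ⟨((2 : ℂ)⁻¹) • (Y + Yᴴ), ?_, fun X hX => ?_⟩
  · rw [Matrix.IsHermitian, Matrix.conjTranspose_smul, Matrix.conjTranspose_add,
      Matrix.conjTranspose_conjTranspose, add_comm]
    simp
  · have h2 : (Yᴴ * X).trace.re = (Y * X).trace.re := by
      have : (Y * X)ᴴ.trace.re = (Y * X).trace.re := by
        rw [Matrix.trace_conjTranspose]; simp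
      rw [← this, Matrix.conjTranspose_mul, hX.eq, Matrix.trace_mul_comm]
    rw [hY, Matrix.smul_mul, Matrix.trace_smul, Matrix.add_mul, Matrix.trace_add, smul_eq_mul,
      Complex.mul_re, Complex.add_re, h2]
    norm_num
    ring

end Positivity

/-! ### The semidefinite program over chains -/

section Chains

variable {α μ : Type*} [Fintype α] [DecidableEq α] [Fintype μ] [DecidableEq μ]

/-- The states on workspace and message that an honest party with workspace `α` can hold just before
its `k` actions `W 0, …, W (k - 1)` and at the end: the adversary cannot change the state of the
workspace. -/
structure IsChain (k : ℕ) (W : ℕ → Matrix (α × μ) (α × μ) ℂ) (ρ : Matrix α α ℂ)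
    (s : ℕ → Matrix (α × μ) (α × μ) ℂ) : Prop where
  posSemidef : ∀ j, j ≤ k → (s j).PosSemidef
  init : leftMarginal (s 0) = ρ
  step : ∀ j, j < k → leftMarginal (s (j + 1)) = leftMarginal (W j * s j * (W j)ᴴ)

/-- Feasible points of the program dual to the maximisation of `tr (T ρ_k)` over chains. -/
structure IsDualChain (k : ℕ) (W : ℕ → Matrix (α × μ) (α × μ) ℂ) (T : Matrix α α ℂ)
    (Z : ℕ → Matrix α α ℂ) : Prop where
  posSemidef : ∀ j, j ≤ k → (Z j).PosSemidef
  step : ∀ j, j < k → (Z j ⊗ₖ (1 : Matrix μ μ ℂ) -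
    (W j)ᴴ * (Z (j + 1) ⊗ₖ (1 : Matrix μ μ ℂ)) * W j).PosSemidef
  terminal : Z k = T

theorem trace_mul_leftMarginal_conj (Z : Matrix α α ℂ) (W s : Matrix (α × μ) (α × μ) ℂ) :
    (Z * leftMarginal (W * s * Wᴴ)).trace =
      (Wᴴ * (Z ⊗ₖ (1 : Matrix μ μ ℂ)) * W * s).trace := by
  rw [← trace_kronecker_one_mul, ← mul_assoc, Matrix.trace_mul_comm, ← mul_assoc, ← mul_assoc]

/-- Moving `W j` onto the dual operator by cyclicity of the trace, the step constraint shows that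
`tr (Z j · leftMarginal (s j))` does not increase with `j`. -/
theorem IsChain.weak_duality {k : ℕ} {W : ℕ → Matrix (α × μ) (α × μ) ℂ} {ρ T : Matrix α α ℂ}
    {s : ℕ → Matrix (α × μ) (α × μ) ℂ} {Z : ℕ → Matrix α α ℂ} (hs : IsChain k W ρ s)
    (hZ : IsDualChain k W T Z) : (T * leftMarginal (s k)).trace.re ≤ (Z 0 * ρ).trace.re := by
  have h : ∀ j, j ≤ k →
      (Z j * leftMarginal (s j)).trace.re ≤ (Z 0 * ρ).trace.re := by
    intro j
    induction j with
    | zero => intro _; rw [hs.init]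
    | succ j ih =>
      intro hj
      refine le_trans ?_ (ih (by omega))
      rw [hs.step j hj, trace_mul_leftMarginal_conj, ← trace_kronecker_one_mul, ← sub_nonneg,
        ← Complex.sub_re, ← Matrix.trace_sub, ← Matrix.sub_mul]
      exact re_trace_mul_nonneg (hZ.step j hj) (hs.posSemidef j (by omega))
  rw [← hZ.terminal]
  exact h k le_rfl

theorem exists_posSemidef_leftMarginal_eq [Nonempty μ] {ρ : Matrix α α ℂ} (hρ : ρ.PosSemidef) :
    ∃ s : Matrix (α × μ) (α × μ) ℂ, s.PosSemidef ∧ leftMarginal s = ρ := by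
  obtain ⟨m⟩ := ‹Nonempty μ›
  refine ⟨ρ ⊗ₖ ketbra (Pi.single m 1), hρ.kronecker (posSemidef_ketbra _), ?_⟩
  rw [leftMarginal_kronecker, trace_ketbra]
  simp

theorem exists_isChain [Nonempty μ] (k : ℕ) (W : ℕ → Matrix (α × μ) (α × μ) ℂ) {ρ : Matrix α α ℂ}
    (hρ : ρ.PosSemidef) : ∃ s, IsChain k W ρ s := by
  have h : ∀ σ : {σ : Matrix α α ℂ // σ.PosSemidef},
      ∃ s : {s : Matrix (α × μ) (α × μ) ℂ // s.PosSemidef}, leftMarginal s.1 = σ.1 := fun σ => by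
    obtain ⟨s, hs, h⟩ := exists_posSemidef_leftMarginal_eq (μ := μ) σ.2
    exact ⟨⟨s, hs⟩, h⟩
  choose F hF using h
  let s : ℕ → {s : Matrix (α × μ) (α × μ) ℂ // s.PosSemidef} := fun j =>
    Nat.rec (F ⟨ρ, hρ⟩)
      (fun i t => F ⟨leftMarginal (W i * t.1 * (W i)ᴴ),
        posSemidef_leftMarginal (t.2.mul_mul_conjTranspose_same _)⟩) j
  exact ⟨fun j => (s j).1, fun j _ => (s j).2, hF _, fun j _ => hF _⟩

/-! ### Strong duality for chains -/

section StrongDuality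

attribute [local instance] Matrix.normedAddCommGroup Matrix.normedSpace

theorem isClosed_posSemidef : IsClosed {s : Matrix α α ℂ | s.PosSemidef} := by
  have h : {s : Matrix α α ℂ | s.PosSemidef} =
      {s | sᴴ = s} ∩ ⋂ v : α → ℂ, {s | 0 ≤ star v ⬝ᵥ (s *ᵥ v)} := by
    ext s
    simp [Matrix.posSemidef_iff_dotProduct_mulVec, Matrix.IsHermitian]
  rw [h]
  refine IsClosed.inter (isClosed_eq (by fun_prop) continuous_id)
    (isClosed_iInter fun v => ?_)
  exact isClosed_le continuous_const (by fun_prop)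

/-- The constraints of the primal program. -/
def chainMap (k : ℕ) (W : ℕ → Matrix (α × μ) (α × μ) ℂ) :
    (Fin (k + 1) → Matrix (α × μ) (α × μ) ℂ) →ₗ[ℝ] (Fin (k + 1) → Matrix α α ℂ) where
  toFun s := Fin.cons (leftMarginal (s 0)) fun j : Fin k =>
    leftMarginal (s j.succ) - leftMarginal (W j * s j.castSucc * (W j)ᴴ)
  map_add' s t := by
    ext j : 1
    refine Fin.cases ?_ (fun j => ?_) j
    · simp
    · simp [mul_add, add_mul]
      abel
  map_smul' c s := by
    ext j : 1
    refine Fin.cases ?_ (fun j => ?_) j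
    · simp
    · simp [smul_sub]

/-- The objective of the primal program. -/
def chainValue (k : ℕ) (T : Matrix α α ℂ) :
    (Fin (k + 1) → Matrix (α × μ) (α × μ) ℂ) →ₗ[ℝ] ℝ where
  toFun s := (T * leftMarginal (s (Fin.last k))).trace.re
  map_add' s t := by simp [mul_add]
  map_smul' c s := by simp

theorem exists_hermitian_of_pi_functional (k : ℕ)
    (f : (Fin (k + 1) → Matrix α α ℂ) →ₗ[ℝ] ℝ) :
    ∃ Y : Fin (k + 1) → Matrix α α ℂ, (∀ j, (Y j).IsHermitian) ∧
      ∀ y : Fin (k + 1) → Matrix α α ℂ, (∀ j, (y j).IsHermitian) →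
        f y = ∑ j, (Y j * y j).trace.re := by
  choose Y hY hf using fun j : Fin (k + 1) =>
    exists_hermitian_of_functional (f ∘ₗ LinearMap.single ℝ (fun _ => Matrix α α ℂ) j)
  refine ⟨Y, hY, fun y hy => ?_⟩
  conv_lhs => rw [← Finset.univ_sum_single y, map_sum]
  exact Finset.sum_congr rfl fun j _ => hf j _ (hy j)

theorem sum_re_trace_mul_single {ι : Type*} [Fintype ι] [DecidableEq ι] (A : ι → Matrix α α ℂ)
    (i : ι) (x : Matrix α α ℂ) :
    ∑ j, (A j * (Pi.single i x : ι → Matrix α α ℂ) j).trace.re = (A i * x).trace.re := by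
  rw [Finset.sum_eq_single i]
  · simp
  · intro j _ hj
    simp [Pi.single_eq_of_ne hj]
  · simp

/-- Needed because the dual functional is represented by matrices only on Hermitian tuples. -/
theorem chainMap_isHermitian {k : ℕ} {W : ℕ → Matrix (α × μ) (α × μ) ℂ}
    {s : Fin (k + 1) → Matrix (α × μ) (α × μ) ℂ} (hs : ∀ j, (s j).PosSemidef) (j : Fin (k + 1)) :
    (chainMap k W s j).IsHermitian := by
  refine Fin.cases ?_ (fun j => ?_) j
  · exact (posSemidef_leftMarginal (hs 0)).1
  · exact (posSemidef_leftMarginal (hs _)).1.sub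
      (posSemidef_leftMarginal ((hs _).mul_mul_conjTranspose_same _)).1

/-- A positive operator with vanishing marginal has trace zero and hence vanishes. The homogeneous
constraints propagate this from `s 0` along the chain. -/
theorem eq_zero_of_chainMap_eq_zero {k : ℕ} {W : ℕ → Matrix (α × μ) (α × μ) ℂ}
    {s : Fin (k + 1) → Matrix (α × μ) (α × μ) ℂ} (hs : ∀ j, (s j).PosSemidef)
    (h : chainMap k W s = 0) : s = 0 := by
  have key : ∀ x : Matrix (α × μ) (α × μ) ℂ, x.PosSemidef → leftMarginal x = 0 → x = 0 :=
    fun x hx h0 => hx.trace_eq_zero_iff.1 (by rw [← trace_leftMarginal, h0, Matrix.trace_zero])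
  funext j
  induction j using Fin.induction with
  | zero => exact key _ (hs 0) (congrFun h 0)
  | succ j ih =>
    refine key _ (hs _) ?_
    have h1 : leftMarginal (s j.succ) - leftMarginal (W j * s j.castSucc * (W j)ᴴ) = 0 :=
      congrFun h j.succ
    rw [ih] at h1
    simpa using h1

/-- A functional that dominates the objective on the cone provides a dual feasible point. -/
theorem isDualChain_of_functional [Nonempty μ] {k : ℕ} {W : ℕ → Matrix (α × μ) (α × μ) ℂ}
    {T : Matrix α α ℂ} (hT : T.PosSemidef) {Y : Fin (k + 1) → Matrix α α ℂ}
    (hY : ∀ j, (Y j).IsHermitian)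
    (h : ∀ s : Fin (k + 1) → Matrix (α × μ) (α × μ) ℂ, (∀ j, (s j).PosSemidef) →
      chainValue k T s ≤ ∑ j, (Y j * chainMap k W s j).trace.re) :
    (Y (Fin.last k) - T).PosSemidef ∧
      IsDualChain k W T fun j => if j = k then T else Y (Fin.ofNat (k + 1) j) := by
  -- This computes the adjoint of `chainMap`. Tuples supported at a single index then isolate one
  -- dual constraint each.
  have hsum : ∀ s : Fin (k + 1) → Matrix (α × μ) (α × μ) ℂ,
      ∑ j, (Y j * chainMap k W s j).trace.re =
        ∑ j, ((Y j ⊗ₖ (1 : Matrix μ μ ℂ)) * s j).trace.re -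
        ∑ j : Fin k, ((W j)ᴴ * (Y j.succ ⊗ₖ (1 : Matrix μ μ ℂ)) * W j * s j.castSucc).trace.re := by
    intro s
    rw [Fin.sum_univ_succ,
      Fin.sum_univ_succ fun j => ((Y j ⊗ₖ (1 : Matrix μ μ ℂ)) * s j).trace.re, add_sub_assoc,
      ← Finset.sum_sub_distrib, trace_kronecker_one_mul]
    congr 1
    refine Finset.sum_congr rfl fun j _ => ?_
    rw [trace_kronecker_one_mul, ← trace_mul_leftMarginal_conj, ← Complex.sub_re,
      ← Matrix.trace_sub, ← Matrix.mul_sub]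
    rfl
  have hpos : ∀ (i : Fin (k + 1)) (x : Matrix (α × μ) (α × μ) ℂ), x.PosSemidef →
      ∀ j, ((Pi.single i x : Fin (k + 1) → Matrix (α × μ) (α × μ) ℂ) j).PosSemidef := by
    intro i x hx j
    by_cases hj : j = i
    · subst hj; simpa using hx
    · rw [Pi.single_eq_of_ne hj]; exact .zero
  have hlast : ((Y (Fin.last k) - T) ⊗ₖ (1 : Matrix μ μ ℂ)).PosSemidef := by
    refine posSemidef_of_re_trace_nonneg ?_ fun x hx => ?_
    · rw [Matrix.IsHermitian, Matrix.conjTranspose_kronecker, ((hY _).sub hT.1).eq,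
        Matrix.conjTranspose_one]
    · have h1 := h _ (hpos (Fin.last k) x hx)
      rw [hsum, sum_re_trace_mul_single] at h1
      simp only [chainValue, LinearMap.coe_mk, AddHom.coe_mk, Pi.single_eq_same] at h1
      rw [Finset.sum_eq_zero fun (j : Fin k) _ => by
        rw [Pi.single_eq_of_ne (Fin.castSucc_lt_last j).ne]; simp, sub_zero,
        trace_kronecker_one_mul] at h1
      rw [trace_kronecker_one_mul, Matrix.sub_mul, Matrix.trace_sub, Complex.sub_re]
      linarith
  have hmid : ∀ j : Fin k, (Y j.castSucc ⊗ₖ (1 : Matrix μ μ ℂ) -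
      (W j)ᴴ * (Y j.succ ⊗ₖ (1 : Matrix μ μ ℂ)) * W j).PosSemidef := by
    intro j
    refine posSemidef_of_re_trace_nonneg ?_ fun x hx => ?_
    · have hk : ∀ i, (Y i ⊗ₖ (1 : Matrix μ μ ℂ)).IsHermitian := fun i => by
        rw [Matrix.IsHermitian, Matrix.conjTranspose_kronecker, (hY i).eq, Matrix.conjTranspose_one]
      exact (hk _).sub (Matrix.isHermitian_conjTranspose_mul_mul _ (hk _))
    · have h1 := h _ (hpos j.castSucc x hx)
      rw [hsum, sum_re_trace_mul_single] at h1
      simp only [chainValue, LinearMap.coe_mk, AddHom.coe_mk] at h1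
      rw [Pi.single_eq_of_ne (Fin.castSucc_lt_last j).ne', Finset.sum_eq_single j
        (fun i _ hi => by
          rw [Pi.single_eq_of_ne fun e => hi (Fin.castSucc_injective k e)]; simp)
        (by simp), Pi.single_eq_same] at h1
      rw [Matrix.sub_mul, Matrix.trace_sub, Complex.sub_re]
      simpa using h1
  have hYT := posSemidef_of_kronecker_one hlast
  -- The functional only provides `Y (Fin.last k) ≥ T`. Replacing this operator by `T` keeps the
  -- last step valid, since it occurs there on the smaller side.
  set Z : ℕ → Matrix α α ℂ := fun j => if j = k then T else Y (Fin.ofNat (k + 1) j) with hZdef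
  have hstep : ∀ j, j < k → (Z j ⊗ₖ (1 : Matrix μ μ ℂ) -
      (W j)ᴴ * (Z (j + 1) ⊗ₖ (1 : Matrix μ μ ℂ)) * W j).PosSemidef := by
    intro j hj
    have hm := hmid ⟨j, hj⟩
    have e1 : Z j = Y (Fin.castSucc ⟨j, hj⟩) := by
      rw [hZdef]
      simp only [hj.ne, if_false]
      congr 1
      exact Fin.ext (Nat.mod_eq_of_lt (by omega))
    rw [e1]
    by_cases hjk : j + 1 = k
    · have e2 : Z (j + 1) = T := by simp [hZdef, hjk]
      have e3 : Fin.succ ⟨j, hj⟩ = Fin.last k := Fin.ext hjk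
      rw [e3] at hm
      rw [e2]
      have := hm.add (hlast.conjTranspose_mul_mul_same (W j))
      convert this using 1
      have hk : (Y (Fin.last k) - T) ⊗ₖ (1 : Matrix μ μ ℂ) =
          Y (Fin.last k) ⊗ₖ (1 : Matrix μ μ ℂ) - T ⊗ₖ (1 : Matrix μ μ ℂ) := by
        ext; simp [sub_mul]
      rw [hk]
      simp only [Matrix.mul_sub, Matrix.sub_mul]
      abel
    · have e2 : Z (j + 1) = Y (Fin.succ ⟨j, hj⟩) := by
        rw [hZdef]
        simp only [hjk, if_false]
        congr 1
        exact Fin.ext (Nat.mod_eq_of_lt (by omega))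
      rw [e2]
      exact hm
  have hZk : Z k = T := by simp [hZdef]
  refine ⟨hYT, fun j hj => ?_, hstep, hZk⟩
  -- Multipliers of equality constraints carry no sign. Positivity comes backwards from `T ≥ 0`,
  -- because each `Z j ⊗ₖ 1` dominates a conjugate of `Z (j + 1) ⊗ₖ 1`.
  induction hj using Nat.decreasingInduction with
  | self => rw [hZk]; exact hT
  | of_succ j hj ih =>
    refine posSemidef_of_kronecker_one (κ := μ) ?_
    have := (hstep j hj).add
      ((ih.kronecker (Matrix.PosSemidef.one (n := μ))).conjTranspose_mul_mul_same (W j))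
    simpa using this

theorem exists_isChain_strong_duality [Nonempty μ] (k : ℕ) (W : ℕ → Matrix (α × μ) (α × μ) ℂ)
    {ρ T : Matrix α α ℂ} (hρ : ρ.PosSemidef) (hT : T.PosSemidef) :
    ∃ s, IsChain k W ρ s ∧ ∀ v, (T * leftMarginal (s k)).trace.re < v →
      ∃ Z, IsDualChain k W T Z ∧ (Z 0 * ρ).trace.re < v := by
  let C : Set (Fin (k + 1) → Matrix (α × μ) (α × μ) ℂ) := {s | ∀ j, (s j).PosSemidef}
  have hC : IsClosed C := by
    have : C = ⋂ j, (fun s => s j) ⁻¹' {s : Matrix (α × μ) (α × μ) ℂ | s.PosSemidef} := by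
      ext s; simp [C]
    rw [this]
    exact isClosed_iInter fun j => isClosed_posSemidef.preimage (continuous_apply j)
  let b : Fin (k + 1) → Matrix α α ℂ := Fin.cons ρ fun _ => 0
  have hb : ∃ s ∈ C, chainMap k W s = b := by
    obtain ⟨s, hs⟩ := exists_isChain k W hρ
    refine ⟨fun j => s j, fun j => hs.posSemidef _ (by omega), ?_⟩
    funext j
    refine Fin.cases ?_ (fun j => ?_) j
    · exact hs.init
    · exact sub_eq_zero.2 (hs.step j j.2)
  obtain ⟨s, hsC, hsb, hdual⟩ := conic_strong_duality hC
    (fun s hs t ht j => (hs j).smul ht)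
    (fun s hs t ht j => (hs j).add (ht j)) (chainMap k W) (chainValue k T)
    (fun s hs h => eq_zero_of_chainMap_eq_zero hs h) b hb
  have hof : ∀ j (hj : j < k + 1), Fin.ofNat (k + 1) j = ⟨j, hj⟩ := fun j hj =>
    Fin.ext (Nat.mod_eq_of_lt hj)
  refine ⟨fun j => s (Fin.ofNat (k + 1) j), ⟨fun j _ => hsC _, congrFun hsb 0, fun j hj => ?_⟩,
    fun v hv => ?_⟩
  · have h1 := congrFun hsb (Fin.succ ⟨j, hj⟩)
    rw [hof j (by omega), hof (j + 1) (by omega)]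
    exact sub_eq_zero.1 h1
  · beta_reduce at hv
    rw [hof k (by omega)] at hv
    obtain ⟨f, hf, hfb⟩ := hdual v hv
    obtain ⟨Y, hY, hfY⟩ := exists_hermitian_of_pi_functional k f
    obtain ⟨hYT, hZ⟩ := isDualChain_of_functional (W := W) hT hY fun s hs => by
      rw [← hfY _ (chainMap_isHermitian hs)]
      exact hf s hs
    refine ⟨_, hZ, lt_of_le_of_lt ?_ hfb⟩
    rw [← hsb, hfY _ (chainMap_isHermitian hsC), hsb, Fin.sum_univ_succ]
    simp only [b, Fin.cons_zero, Fin.cons_succ, mul_zero, Matrix.trace_zero, Complex.zero_re,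
      Finset.sum_const_zero, add_zero]
    -- With no honest action, `Z 0` is `T` instead of `Y 0`, and `Y 0 ≥ T` supplies the inequality.
    by_cases hk : 0 = k
    · subst hk
      simp only [if_true]
      rw [← sub_nonneg, ← Complex.sub_re, ← Matrix.trace_sub, ← Matrix.sub_mul]
      exact re_trace_mul_nonneg hYT hρ
    · simp [hk]

end StrongDuality

end Chains

/-! ### Purifications and realisation of chains -/

section Purification

variable {α κ μ : Type*} [Fintype α] [DecidableEq α] [Fintype κ] [DecidableEq κ] [Fintype μ]
  [DecidableEq μ]

/-- Equal norms give `P` and `Q` the same kernel, so `P c ↦ Q c` is a well-defined isometry on the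
range of `P`. It extends to the whole space by finite dimension. -/
theorem exists_linearIsometry_of_norm_eq {V F : Type*} [AddCommGroup V] [Module ℂ V]
    [NormedAddCommGroup F] [InnerProductSpace ℂ F] [FiniteDimensional ℂ F] (P Q : V →ₗ[ℂ] F)
    (h : ∀ c, ‖P c‖ = ‖Q c‖) : ∃ U : F →ₗᵢ[ℂ] F, ∀ c, U (P c) = Q c := by
  obtain ⟨g, hg⟩ := P.rangeRestrict.exists_rightInverse_of_surjective P.range_rangeRestrict
  have hg' : ∀ y, P (g y) = y := fun y => congrArg Subtype.val (LinearMap.congr_fun hg y)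
  let T : P.range →ₗᵢ[ℂ] F := ⟨Q ∘ₗ g, fun y => by
    rw [LinearMap.comp_apply, ← h, hg']; rfl⟩
  refine ⟨T.extend, fun c => ?_⟩
  have h1 : T.extend (P c) = T ⟨P c, c, rfl⟩ := T.extend_apply ⟨P c, c, rfl⟩
  rw [h1]
  change Q (g _) = Q c
  rw [← sub_eq_zero, ← map_sub, ← norm_eq_zero, ← h, map_sub, hg', sub_self, norm_zero]

/-- Two purifications of the same operator differ by a unitary on the purifying system. -/
theorem exists_unitary_of_leftMarginal_eq (φ χ : α × κ → ℂ)
    (h : leftMarginal (ketbra φ) = leftMarginal (ketbra χ)) :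
    ∃ V ∈ Matrix.unitaryGroup κ ℂ, ((1 : Matrix α α ℂ) ⊗ₖ V) *ᵥ φ = χ := by
  -- A bipartite vector is read as a linear map into the purifying space. Its Gram matrix is
  -- determined by the marginal, so equal marginals give equal norms.
  let P : (α × κ → ℂ) → (α → ℂ) →ₗ[ℂ] EuclideanSpace ℂ κ := fun φ =>
    Fintype.linearCombination ℂ fun a => WithLp.toLp 2 fun m => φ (a, m)
  have hinner : ∀ (φ : α × κ → ℂ) c, inner ℂ (P φ c) (P φ c) =
      ∑ a, ∑ a', star (c a) * (c a' * leftMarginal (ketbra φ) a' a) := by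
    intro φ c
    simp only [P, Fintype.linearCombination_apply, sum_inner, inner_sum, inner_smul_left,
      inner_smul_right, Finset.mul_sum]
    rw [Finset.sum_comm]
    refine Finset.sum_congr rfl fun a _ => Finset.sum_congr rfl fun a' _ => ?_
    rw [mul_left_comm]
    simp [leftMarginal_apply, ketbra, Matrix.vecMulVec_apply, PiLp.inner_apply]
  have hnorm : ∀ c, ‖P φ c‖ = ‖P χ c‖ := fun c => by
    rw [@norm_eq_sqrt_re_inner ℂ, @norm_eq_sqrt_re_inner ℂ, hinner, hinner, h]
  obtain ⟨U, hU⟩ := exists_linearIsometry_of_norm_eq (P φ) (P χ) hnorm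
  let V : Matrix κ κ ℂ := Matrix.toEuclideanLin.symm U.toLinearMap
  have hV : ∀ x, Matrix.toEuclideanLin V x = U x := fun x => by simp [V]
  refine ⟨V, ?_, ?_⟩
  · rw [Matrix.mem_unitaryGroup_iff', Matrix.star_eq_conjTranspose]
    apply Matrix.toEuclideanLin.injective
    refine LinearMap.ext fun x => ext_inner_left ℂ fun y => ?_
    rw [Matrix.toLpLin_mul_same, LinearMap.comp_apply,
      Matrix.toEuclideanLin_conjTranspose_eq_adjoint,
      LinearMap.adjoint_inner_right, hV, hV, U.inner_map_map]
    simp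
  · funext ⟨a, m⟩
    have h1 := hU (Pi.single a 1)
    rw [← hV] at h1
    have h2 := congrArg (fun x : EuclideanSpace ℂ κ => x m) h1
    simp only [P, Fintype.linearCombination_apply_single, one_smul, Matrix.toLpLin_toLp] at h2
    rw [← h2]
    simp [Matrix.mulVec, dotProduct, Fintype.sum_prod_type, Matrix.one_apply]

/-- Write `s = R * Rᴴ` and let the memory index the columns of `R`. The memory dimension does not
depend on `s`, so one memory serves a whole chain. -/
theorem exists_purification {s : Matrix (α × μ) (α × μ) ℂ} (hs : s.PosSemidef) :
    ∃ φ : α × μ × Fin (Fintype.card (α × μ)) → ℂ, dropRight (ketbra φ) = s := by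
  obtain ⟨R, rfl⟩ := exists_eq_mul_conjTranspose hs
  refine ⟨fun x => R (x.1, x.2.1) ((Fintype.equivFin (α × μ)).symm x.2.2), ?_⟩
  ext x y
  rw [Matrix.mul_apply, ← (Fintype.equivFin (α × μ)).symm.sum_comp]
  rfl

/-- A chain is realised by an adversary who prepares a pure state and acts unitarily. -/
theorem IsChain.exists_realization [Nonempty μ] {k : ℕ} {W : ℕ → Matrix (α × μ) (α × μ) ℂ}
    {ψ : α → ℂ} (hψ : star ψ ⬝ᵥ ψ = 1) {s : ℕ → Matrix (α × μ) (α × μ) ℂ}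
    (hs : IsChain k W (ketbra ψ) s) :
    ∃ (d : ℕ) (η : μ × Fin d → ℂ) (V : ℕ → Matrix (μ × Fin d) (μ × Fin d) ℂ)
      (φ : ℕ → α × μ × Fin d → ℂ), star η ⬝ᵥ η = 1 ∧ (∀ j, V j ∈ Matrix.unitaryGroup _ ℂ) ∧
      (φ 0 = fun x => ψ x.1 * η x.2) ∧
      (∀ j, j < k → φ (j + 1) = actRight α (V j) *ᵥ (actLeft (Fin d) (W j) *ᵥ φ j)) ∧
      ∀ j, j ≤ k → dropRight (ketbra (φ j)) = s j := by
  have hα : Nonempty α := by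
    by_contra h
    rw [not_nonempty_iff] at h
    simp [dotProduct] at hψ
  obtain ⟨a₀⟩ := hα
  obtain ⟨m₀⟩ := ‹Nonempty μ›
  choose! φ hφ using fun j (hj : j ≤ k) => exists_purification (hs.posSemidef j hj)
  have hmarg : ∀ j, j ≤ k → leftMarginal (ketbra (φ j)) = leftMarginal (s j) := fun j hj => by
    rw [← leftMarginal_dropRight, hφ j hj]
  let e : μ × Fin (Fintype.card (α × μ)) → ℂ :=
    Pi.single (m₀, Fintype.equivFin (α × μ) (a₀, m₀)) 1
  have he : star e ⬝ᵥ e = 1 := by simp [e]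
  -- The product of `ψ` with any unit vector has marginal `ketbra ψ`, as does `φ 0`. A unitary on
  -- message and memory relates them, so `φ 0` is itself a product with `V₀ *ᵥ e`.
  obtain ⟨V₀, hV₀, h0⟩ := exists_unitary_of_leftMarginal_eq (fun x => ψ x.1 * e x.2) (φ 0) (by
    rw [hmarg 0 (Nat.zero_le k), hs.init, ketbra_product, leftMarginal_kronecker, trace_ketbra, he,
      one_smul])
  have hstep : ∀ j, ∃ V ∈ Matrix.unitaryGroup (μ × Fin (Fintype.card (α × μ))) ℂ,
      j < k → actRight α V *ᵥ (actLeft (Fin _) (W j) *ᵥ φ j) = φ (j + 1) := by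
    intro j
    by_cases hj : j < k
    · obtain ⟨V, hV, h⟩ := exists_unitary_of_leftMarginal_eq
        (actLeft (Fin _) (W j) *ᵥ φ j) (φ (j + 1)) (by
          rw [hmarg (j + 1) hj, hs.step j hj, ketbra_mulVec, ← leftMarginal_dropRight,
            dropRight_conj, hφ j hj.le])
      exact ⟨V, hV, fun _ => h⟩
    · exact ⟨1, one_mem _, fun h => absurd h hj⟩
  choose V hV hVφ using hstep
  refine ⟨_, V₀ *ᵥ e, V, φ, ?_, hV, ?_, fun j hj => (hVφ j hj).symm, hφ⟩
  · rw [Matrix.star_mulVec, Matrix.dotProduct_mulVec, Matrix.vecMul_vecMul,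
      ← Matrix.star_eq_conjTranspose, Matrix.mem_unitaryGroup_iff'.1 hV₀, Matrix.vecMul_one, he]
  · rw [← h0]
    funext ⟨a, x⟩
    simp only [Matrix.mulVec, dotProduct, Fintype.sum_prod_type, Matrix.kroneckerMap_apply,
      Matrix.one_apply, ite_mul, one_mul, zero_mul, Finset.mul_sum]
    rw [Finset.sum_eq_single a]
    · simp [mul_left_comm]
    · intro b _ hb
      simp [Ne.symm hb]
    · simp

end Purification

/-! ### Making the initial state an eigenvector -/

section Perturbation

variable {ι : Type*} [Fintype ι] [DecidableEq ι]

theorem expect_eq (Z : Matrix ι ι ℂ) (v : ι → ℂ) : expect Z v = (star v ⬝ᵥ (Z *ᵥ v)).re := by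
  rw [expect, trace_mul_ketbra]

theorem ketbra_mulVec_apply (ψ x : ι → ℂ) : ketbra ψ *ᵥ x = (star ψ ⬝ᵥ x) • ψ := by
  rw [ketbra, Matrix.vecMulVec_mulVec]
  simp

theorem perturb_mulVec_self {ψ : ι → ℂ} (hψ : star ψ ⬝ᵥ ψ = 1) (Z : Matrix ι ι ℂ) (ε : ℝ) :
    perturb Z ψ ε *ᵥ ψ = ((expect Z ψ + ε : ℝ) : ℂ) • ψ := by
  rw [perturb, Matrix.add_mulVec, Matrix.smul_mulVec, Matrix.smul_mulVec, Matrix.sub_mulVec,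
    ketbra_mulVec_apply, hψ, Matrix.one_mulVec, one_smul, sub_self, smul_zero, add_zero]

theorem isHermitian_perturb (Z : Matrix ι ι ℂ) (ψ : ι → ℂ) (ε : ℝ) :
    (perturb Z ψ ε).IsHermitian := by
  have h := (posSemidef_ketbra ψ).1
  rw [perturb, Matrix.IsHermitian, Matrix.conjTranspose_add, Matrix.conjTranspose_smul,
    Matrix.conjTranspose_smul, Matrix.conjTranspose_sub, h.eq, Matrix.conjTranspose_one]
  simp

theorem re_inner_smul_add_le {E : Type*} [NormedAddCommGroup E] [InnerProductSpace ℂ E]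
    (T : E →L[ℂ] E) {p : E} (hp : ‖p‖ = 1) (a : ℂ) (y : E) :
    (inner ℂ (a • p + y) (T (a • p + y))).re ≤
      ‖a‖ ^ 2 * (inner ℂ p (T p)).re + 2 * (‖a‖ * ‖T‖ * ‖y‖) + ‖T‖ * ‖y‖ ^ 2 := by
  have hbound : ∀ u v : E, ‖inner ℂ u (T v)‖ ≤ ‖u‖ * (‖T‖ * ‖v‖) := fun u v =>
    (norm_inner_le_norm _ _).trans (by gcongr; exact T.le_opNorm v)
  have h1 : (inner ℂ (a • p) (T y)).re ≤ ‖a‖ * ‖T‖ * ‖y‖ :=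
    (Complex.re_le_norm _).trans ((hbound _ _).trans_eq (by rw [norm_smul, hp]; ring))
  have h2 : (inner ℂ y (T (a • p))).re ≤ ‖a‖ * ‖T‖ * ‖y‖ :=
    (Complex.re_le_norm _).trans ((hbound _ _).trans_eq (by rw [norm_smul, hp]; ring))
  have h3 : (inner ℂ y (T y)).re ≤ ‖T‖ * ‖y‖ ^ 2 :=
    (Complex.re_le_norm _).trans ((hbound _ _).trans_eq (by ring))
  have h4 : (inner ℂ (a • p) (T (a • p))).re = ‖a‖ ^ 2 * (inner ℂ p (T p)).re := by
    rw [map_smul, inner_smul_left, inner_smul_right, ← mul_assoc, Complex.conj_mul',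
      ← Complex.ofReal_pow, Complex.re_ofReal_mul]
  rw [map_add, inner_add_left, inner_add_right, inner_add_right]
  simp only [Complex.add_re]
  linarith

/-- Split `x = a • ψ + y` with `y` orthogonal to `ψ`. Bounding the cross terms and the `y` term of
`Z` by the operator norm leaves at least `ε|a|² - 2‖Z‖|a|‖y‖ + (‖Z‖²/ε)‖y‖²`, which is the square
`(ε|a| - ‖Z‖‖y‖)²/ε`. This dictates the coefficient in `perturb`. -/
theorem posSemidef_perturb_sub {Z : Matrix ι ι ℂ} (hZ : Z.IsHermitian) {ψ : ι → ℂ}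
    (hψ : star ψ ⬝ᵥ ψ = 1) {ε : ℝ} (hε : 0 < ε) : (perturb Z ψ ε - Z).PosSemidef := by
  have hH := (isHermitian_perturb Z ψ ε).sub hZ
  refine .of_dotProduct_mulVec_nonneg hH fun x => ?_
  rw [Complex.nonneg_iff]
  refine ⟨?_, (hH.im_star_dotProduct_mulVec_self x).symm⟩
  set a : ℂ := star ψ ⬝ᵥ x with ha
  set y : ι → ℂ := x - a • ψ with hy
  have hinner : ∀ u v : ι → ℂ, inner ℂ (WithLp.toLp 2 u) (WithLp.toLp 2 v) = star u ⬝ᵥ v :=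
    fun u v => by rw [EuclideanSpace.inner_toLp_toLp, dotProduct_comm]
  have hnorm : ∀ u : ι → ℂ, ‖WithLp.toLp 2 u‖ ^ 2 = (star u ⬝ᵥ u).re := fun u => by
    rw [← hinner, ← inner_self_eq_norm_sq (𝕜 := ℂ)]; rfl
  have hp : ‖WithLp.toLp 2 ψ‖ = 1 := by
    have := hnorm ψ
    rw [hψ, Complex.one_re] at this
    exact (pow_eq_one_iff_of_nonneg (norm_nonneg _) two_ne_zero).1 this
  have hxa : star x ⬝ᵥ ψ = star a := Matrix.star_dotProduct x ψ
  have hx : WithLp.toLp 2 x = a • WithLp.toLp 2 ψ + WithLp.toLp 2 y := by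
    rw [← WithLp.toLp_smul, ← WithLp.toLp_add, hy]
    simp
  have haa : star a * a = ((‖a‖ ^ 2 : ℝ) : ℂ) := by
    rw [Complex.ofReal_pow, ← Complex.conj_mul']; rfl
  have hyy : (star x ⬝ᵥ x).re = ‖a‖ ^ 2 + ‖WithLp.toLp 2 y‖ ^ 2 := by
    have : star y ⬝ᵥ y = star x ⬝ᵥ x - star a * a := by
      rw [hy, star_sub, star_smul, sub_dotProduct, dotProduct_sub, dotProduct_sub,
        dotProduct_smul, dotProduct_smul, smul_dotProduct, smul_dotProduct, hψ, hxa, ← ha]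
      simp only [smul_eq_mul]
      ring
    rw [hnorm, this, haa, Complex.sub_re, Complex.ofReal_re]
    ring
  have hpert : (star x ⬝ᵥ (perturb Z ψ ε *ᵥ x)).re = (expect Z ψ + ε) * ‖a‖ ^ 2 +
      (opNorm Z ^ 2 / ε + opNorm Z) * ‖WithLp.toLp 2 y‖ ^ 2 := by
    rw [perturb, Matrix.add_mulVec, Matrix.smul_mulVec, Matrix.smul_mulVec, Matrix.sub_mulVec,
      ketbra_mulVec_apply, Matrix.one_mulVec, ← ha, dotProduct_add, dotProduct_smul,
      dotProduct_smul, dotProduct_smul, dotProduct_sub, dotProduct_smul, hxa, smul_eq_mul,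
      smul_eq_mul, smul_eq_mul, mul_comm a, haa, Complex.add_re, Complex.re_ofReal_mul,
      Complex.re_ofReal_mul, Complex.sub_re, hyy, Complex.ofReal_re]
    ring
  have hT := re_inner_smul_add_le (Matrix.toEuclideanCLM (n := ι) (𝕜 := ℂ) Z) hp a
    (WithLp.toLp 2 y)
  rw [← hx, Matrix.toEuclideanCLM_toLp, Matrix.toEuclideanCLM_toLp, hinner, hinner, ← expect_eq,
    ← expect_eq, ← opNorm] at hT
  rw [Matrix.sub_mulVec, dotProduct_sub, Complex.sub_re, hpert]
  set r := ‖WithLp.toLp 2 y‖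
  have hsq : 0 ≤ (ε * ‖a‖ - opNorm Z * r) ^ 2 / ε := by positivity
  have hexp : (ε * ‖a‖ - opNorm Z * r) ^ 2 / ε =
      ε * ‖a‖ ^ 2 + opNorm Z ^ 2 / ε * r ^ 2 - 2 * (‖a‖ * opNorm Z * r) := by
    field_simp
    ring
  rw [← expect_eq]
  linarith

theorem posSemidef_perturb {Z : Matrix ι ι ℂ} (hZ : Z.PosSemidef) {ψ : ι → ℂ}
    (hψ : star ψ ⬝ᵥ ψ = 1) {ε : ℝ} (hε : 0 < ε) : (perturb Z ψ ε).PosSemidef := by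
  simpa using (posSemidef_perturb_sub hZ.1 hψ hε).add hZ

end Perturbation

theorem sum_outcome {M : Type*} [AddCommMonoid M] (f : Outcome → M) :
    ∑ a, f a = f .zero + (f .one + f .abort) := by
  change ∑ a ∈ {Outcome.zero, Outcome.one, Outcome.abort}, f a = _
  rw [Finset.sum_insert (by decide), Finset.sum_pair (by decide)]

/-! ### From chains to rewards and dual programs -/

section General

variable {α κ μ δ : Type*} [Fintype α] [DecidableEq α] [Fintype κ] [DecidableEq κ] [Fintype μ]
  [DecidableEq μ] [Fintype δ] [DecidableEq δ]

theorem IsChain.of_states {k : ℕ} {W : ℕ → Matrix (α × μ) (α × μ) ℂ} {ρ : Matrix α α ℂ}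
    {σ : ℕ → Matrix (α × μ × δ) (α × μ × δ) ℂ} (hpos : ∀ j, (σ j).PosSemidef)
    (h0 : leftMarginal (σ 0) = ρ)
    (hstep : ∀ j, j < k → leftMarginal (σ (j + 1)) =
      leftMarginal (actLeft δ (W j) * σ j * (actLeft δ (W j))ᴴ)) :
    IsChain k W ρ fun j => dropRight (σ j) where
  posSemidef j _ := posSemidef_dropRight (hpos j)
  init := by rw [leftMarginal_dropRight, h0]
  step j hj := by rw [leftMarginal_dropRight, hstep j hj, ← leftMarginal_dropRight, dropRight_conj]

/-- If the rewards are the values of the chains and the constraints are those of the dual program,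
then the maximal reward is attained and equals the value of the dual program. -/
theorem isGreatest_and_isGLB_of_chains [Nonempty μ] {k : ℕ} {W : ℕ → Matrix (α × μ) (α × μ) ℂ}
    {ψ : α → ℂ} {T : Matrix α α ℂ} (hT : T.PosSemidef) {R : Set ℝ}
    {D : (ℕ → Matrix α α ℂ) → Prop}
    (hR : ∀ x ∈ R, ∃ s, IsChain k W (ketbra ψ) s ∧ x = (T * leftMarginal (s k)).trace.re)
    (hR' : ∀ s, IsChain k W (ketbra ψ) s → (T * leftMarginal (s k)).trace.re ∈ R)
    (hD : ∀ Z, D Z → ∃ Z', IsDualChain k W T Z' ∧ Z' 0 = Z 0)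
    (hD' : ∀ Z', IsDualChain k W T Z' → ∃ Z, D Z ∧ Z' 0 = Z 0) :
    IsGreatest R (sSup R) ∧ IsGLB {x : ℝ | ∃ Z, D Z ∧ x = expect (Z 0) ψ} (sSup R) := by
  obtain ⟨s, hs, hdual⟩ := exists_isChain_strong_duality k W (posSemidef_ketbra ψ) hT
  have hweak : ∀ x ∈ R, ∀ Z, D Z → x ≤ expect (Z 0) ψ := by
    intro x hx Z hZ
    obtain ⟨t, ht, rfl⟩ := hR x hx
    obtain ⟨Z', hZ', h0⟩ := hD Z hZ
    rw [← h0]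
    exact ht.weak_duality hZ'
  have hinf : ∀ v, (T * leftMarginal (s k)).trace.re < v → ∃ Z, D Z ∧ expect (Z 0) ψ < v := by
    intro v hv
    obtain ⟨Z', hZ', h⟩ := hdual v hv
    obtain ⟨Z, hZ, h0⟩ := hD' Z' hZ'
    rw [h0] at h
    exact ⟨Z, hZ, h⟩
  -- Every reward lies below every dual value, and dual values come arbitrarily close to that of the
  -- optimal chain.
  have hgr : IsGreatest R (T * leftMarginal (s k)).trace.re :=
    ⟨hR' s hs, fun x hx => le_of_forall_gt fun v hv => by
      obtain ⟨Z, hZ, h⟩ := hinf v hv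
      exact (hweak x hx Z hZ).trans_lt h⟩
  rw [hgr.csSup_eq]
  refine ⟨hgr, ?_, fun w hw => le_of_forall_gt fun v hv => ?_⟩
  · rintro _ ⟨Z, hZ, rfl⟩
    exact hweak _ hgr.1 Z hZ
  · obtain ⟨Z, hZ, h⟩ := hinf v hv
    exact (hw ⟨Z, hZ, rfl⟩).trans_lt h

theorem posSemidef_weighted {p q : ℝ} (hp : 0 ≤ p) (hq : 0 ≤ q) {A B : Matrix α α ℂ}
    (hA : A.PosSemidef) (hB : B.PosSemidef) : ((p : ℂ) • A + (q : ℂ) • B).PosSemidef :=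
  (hA.smul (by exact_mod_cast hp)).add (hB.smul (by exact_mod_cast hq))

theorem re_trace_weighted_mul (p q : ℝ) (A B X : Matrix α α ℂ) :
    (((p : ℂ) • A + (q : ℂ) • B) * X).trace.re = p * (A * X).trace.re + q * (B * X).trace.re := by
  rw [Matrix.add_mul, Matrix.smul_mul, Matrix.smul_mul, Matrix.trace_add, Matrix.trace_smul,
    Matrix.trace_smul, Complex.add_re, smul_eq_mul, smul_eq_mul, Complex.re_ofReal_mul,
    Complex.re_ofReal_mul]

end General

variable {n : ℕ} {𝒜 ℳ ℬ : Type*} [Fintype 𝒜] [DecidableEq 𝒜] [Fintype ℳ] [DecidableEq ℳ]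
  [Fintype ℬ] [DecidableEq ℬ]

/-! ### Malicious Bob against honest Alice -/

section MaliciousBob

/-- The action of honest Alice in message `2 * j + 1`, on the event that she does not abort. -/
def Scheme.aliceOp (S : Scheme n 𝒜 ℳ ℬ) (j : ℕ) : Matrix (𝒜 × ℳ) (𝒜 × ℳ) ℂ :=
  S.UA (2 * j + 1) * S.EA (2 * j)

/-- The operator of Bob's points on Alice's final workspace. -/
def Scheme.aliceTerminal (S : Scheme n 𝒜 ℳ ℬ) (Λ : ℝ) : Matrix 𝒜 𝒜 ℂ :=
  (Λ : ℂ) • S.PiA .zero + ((Λ + 1 : ℝ) : ℂ) • S.PiA .one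

theorem Scheme.bobReward_eq (S : Scheme n 𝒜 ℳ ℬ) (Λ : ℝ) {d : ℕ} (T : Strategy (ℳ × Fin d)) :
    S.bobReward Λ T = (S.aliceTerminal Λ * leftMarginal (S.stateVsBob T n)).trace.re := by
  rw [Scheme.bobReward, sum_outcome, Scheme.aliceTerminal, re_trace_weighted_mul]
  simp only [bobPoints, trace_kronecker_one_mul, zero_mul, add_zero]

theorem Scheme.stateVsBob_odd (S : Scheme n 𝒜 ℳ ℬ) {d : ℕ} (T : Strategy (ℳ × Fin d)) (j : ℕ) :
    S.stateVsBob T (2 * j + 1) = actLeft (Fin d) (S.aliceOp j) * S.stateVsBob T (2 * j) *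
      (actLeft (Fin d) (S.aliceOp j))ᴴ := by
  rw [Scheme.stateVsBob, if_pos (odd_two_mul_add_one j), Scheme.aliceOp]

theorem Scheme.stateVsBob_even (S : Scheme n 𝒜 ℳ ℬ) {d : ℕ} (T : Strategy (ℳ × Fin d)) (j : ℕ) :
    S.stateVsBob T (2 * (j + 1)) = ∑ k, actRight 𝒜 (T.kraus (2 * (j + 1)) k) *
      S.stateVsBob T (2 * j + 1) * (actRight 𝒜 (T.kraus (2 * (j + 1)) k))ᴴ := by
  change S.stateVsBob T (2 * j + 1 + 1) = _
  rw [Scheme.stateVsBob, if_neg (Nat.not_odd_iff_even.2 ⟨j + 1, by ring⟩)]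
  rfl

theorem Scheme.posSemidef_stateVsBob (S : Scheme n 𝒜 ℳ ℬ) {d : ℕ} (T : Strategy (ℳ × Fin d))
    (i : ℕ) : (S.stateVsBob T i).PosSemidef := by
  induction i with
  | zero => exact (posSemidef_ketbra _).kronecker T.init_nonneg
  | succ i ih =>
    rw [Scheme.stateVsBob]
    split_ifs
    · exact ih.mul_mul_conjTranspose_same _
    · exact Matrix.posSemidef_sum _ fun k _ => ih.mul_mul_conjTranspose_same _

/-- The chain samples the state just before each of Alice's actions. Bob's channel in between leaves
her marginal unchanged. -/
theorem Scheme.isChain_stateVsBob (S : Scheme n 𝒜 ℳ ℬ) {d : ℕ} (T : Strategy (ℳ × Fin d))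
    (k : ℕ) : IsChain k S.aliceOp (ketbra S.ψA) fun j => dropRight (S.stateVsBob T (2 * j)) := by
  refine IsChain.of_states (fun j => S.posSemidef_stateVsBob T _) ?_ fun j _ => ?_
  · rw [mul_zero, Scheme.stateVsBob, leftMarginal_kronecker, T.init_trace, one_smul]
  · rw [Scheme.stateVsBob_even, ← Scheme.stateVsBob_odd]
    exact leftMarginal_channel _ (T.kraus_complete _) _

/-- The strategy that prepares the pure state `η` and applies the unitaries `V i`. -/
def Strategy.ofUnitaries {κ : Type*} [Fintype κ] [DecidableEq κ] (η : κ → ℂ)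
    (hη : star η ⬝ᵥ η = 1) (V : ℕ → Matrix κ κ ℂ) (hV : ∀ i, V i ∈ Matrix.unitaryGroup κ ℂ) :
    Strategy κ where
  init := ketbra η
  init_nonneg := posSemidef_ketbra η
  init_trace := by rw [trace_ketbra, hη]
  r := 1
  kraus i _ := V i
  kraus_complete i := by
    rw [Finset.univ_unique, Finset.sum_singleton]
    exact Matrix.mem_unitaryGroup_iff'.1 (hV i)

theorem Scheme.exists_bobReward_eq [Nonempty ℳ] (S : Scheme n 𝒜 ℳ ℬ) (Λ : ℝ)
    (hψ : star S.ψA ⬝ᵥ S.ψA = 1) {k : ℕ} (hn : n = 2 * k) {s : ℕ → Matrix (𝒜 × ℳ) (𝒜 × ℳ) ℂ}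
    (hs : IsChain k S.aliceOp (ketbra S.ψA) s) :
    (S.aliceTerminal Λ * leftMarginal (s k)).trace.re ∈ S.bobRewards Λ := by
  obtain ⟨d, η, V, φ, hη, hV, h0, hstep, hφ⟩ := hs.exists_realization hψ
  -- Message `2 * (j + 1)` is Bob's reply to Alice's action `j`, hence the index shift.
  let T : Strategy (ℳ × Fin d) := .ofUnitaries η hη (fun i => V (i / 2 - 1)) fun i => hV _
  have hstate : ∀ j, j ≤ k → S.stateVsBob T (2 * j) = ketbra (φ j) := by
    intro j
    induction j with
    | zero =>
      intro _
      rw [h0, ketbra_product]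
      rfl
    | succ j ih =>
      intro hj
      have hK : ∀ r, T.kraus (2 * (j + 1)) r = V j := fun r => by
        change V (2 * (j + 1) / 2 - 1) = V j
        congr 1
        omega
      rw [Scheme.stateVsBob_even, Scheme.stateVsBob_odd, ih (by omega), hstep j hj, ketbra_mulVec,
        ketbra_mulVec]
      simp_rw [hK]
      exact Fin.sum_univ_one _
  refine ⟨d, T, ?_⟩
  subst hn
  rw [S.bobReward_eq, hstate k le_rfl, ← hφ k le_rfl, leftMarginal_dropRight]

theorem Protocol.aliceOp_conj (P : Protocol n 𝒜 ℳ ℬ) {j : ℕ} (hj : 2 * j < n)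
    (X : Matrix (𝒜 × ℳ) (𝒜 × ℳ) ℂ) :
    (P.aliceOp j)ᴴ * X * P.aliceOp j =
      P.EA (2 * j) * (P.UA (2 * j + 1))ᴴ * X * P.UA (2 * j + 1) * P.EA (2 * j) := by
  have h : (P.EA (2 * j))ᴴ = P.EA (2 * j) :=
    (P.projA (2 * j) hj (even_two_mul j)).isSelfAdjoint
  rw [Scheme.aliceOp, Matrix.conjTranspose_mul, h]
  simp only [mul_assoc]

theorem Protocol.isDualChain_of_dualA (P : Protocol n 𝒜 ℳ ℬ) {Λ : ℝ} {k : ℕ} (hn : n = 2 * k)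
    {Z : ℕ → Matrix 𝒜 𝒜 ℂ} (hZ : P.DualA Λ Z) :
    IsDualChain k P.aliceOp (P.aliceTerminal Λ) fun j => Z (2 * j) where
  posSemidef j hj := hZ.nonneg _ (by omega)
  step j hj := by
    have h := hZ.step (2 * j) (by omega) (odd_two_mul_add_one j)
    rw [hZ.keep (2 * j + 1) (by omega) ⟨j + 1, by ring⟩] at h
    rw [P.aliceOp_conj (by omega)]
    exact h
  terminal := by rw [← hn]; exact hZ.terminal

/-- Rounding up pairs index `2 * j + 1` with `2 * j + 2`, as the equality constraints of Bob's
messages demand. -/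
theorem Protocol.dualA_of_isDualChain (P : Protocol n 𝒜 ℳ ℬ) {Λ : ℝ} {k : ℕ} (hn : n = 2 * k)
    {Z : ℕ → Matrix 𝒜 𝒜 ℂ} (hZ : IsDualChain k P.aliceOp (P.aliceTerminal Λ) Z) :
    P.DualA Λ fun i => Z ((i + 1) / 2) where
  nonneg i hi := hZ.posSemidef _ (by omega)
  step i hi hodd := by
    obtain ⟨j, hj⟩ := hodd
    obtain rfl : i = 2 * j := by omega
    have h := hZ.step j (by omega)
    rw [P.aliceOp_conj hi] at h
    rw [show (2 * j + 1) / 2 = j by omega, show (2 * j + 1 + 1) / 2 = j + 1 by omega]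
    exact h
  keep i hi heven := by
    obtain ⟨j, hj⟩ := heven
    congr 1
    omega
  terminal := by
    rw [show (n + 1) / 2 = k by omega]
    exact hZ.terminal

theorem Protocol.nonempty_message (P : Protocol n 𝒜 ℳ ℬ) : Nonempty ℳ := by
  by_contra h
  rw [not_nonempty_iff] at h
  simpa [dotProduct] using P.norm_ψM

theorem Protocol.bob_optimum (P : Protocol n 𝒜 ℳ ℬ) {Λ : ℝ} (hΛ : 0 ≤ Λ) :
    IsGreatest (P.bobRewards Λ) (P.RB Λ) ∧
      IsGLB {x : ℝ | ∃ Z, P.DualA Λ Z ∧ x = expect (Z 0) P.ψA} (P.RB Λ) := by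
  have := P.nonempty_message
  obtain ⟨k, hk⟩ := P.n_even
  have hn : n = 2 * k := by omega
  refine isGreatest_and_isGLB_of_chains (k := k) (W := P.aliceOp) (T := P.aliceTerminal Λ)
    (posSemidef_weighted hΛ (by linarith) (P.povmA_nonneg _) (P.povmA_nonneg _)) ?_
    (fun s hs => P.exists_bobReward_eq Λ P.norm_ψA hn hs)
    (fun Z hZ => ⟨_, P.isDualChain_of_dualA hn hZ, rfl⟩)
    (fun Z hZ => ⟨_, P.dualA_of_isDualChain hn hZ, rfl⟩)
  rintro _ ⟨d, T, rfl⟩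
  refine ⟨_, P.isChain_stateVsBob T k, ?_⟩
  rw [P.bobReward_eq, leftMarginal_dropRight, ← hn]

end MaliciousBob

/-! ### Malicious Alice against honest Bob, by reversing the tensor factors -/

section MaliciousAlice

/-- Reversal of the order of three tensor factors. -/
def flipThree (α β γ : Type*) : α × β × γ ≃ γ × β × α where
  toFun x := (x.2.2, x.2.1, x.1)
  invFun x := (x.2.2, x.2.1, x.1)
  left_inv _ := rfl
  right_inv _ := rfl

/-- The operator `X` with the two tensor factors exchanged. -/
def swapOp {α β : Type*} (X : Matrix (α × β) (α × β) ℂ) : Matrix (β × α) (β × α) ℂ :=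
  X.submatrix (Equiv.prodComm β α) (Equiv.prodComm β α)

theorem swapOp_mul {α β : Type*} [Fintype α] [Fintype β] (X Y : Matrix (α × β) (α × β) ℂ) :
    swapOp (X * Y) = swapOp X * swapOp Y :=
  (Matrix.submatrix_mul_equiv _ _ _ (Equiv.prodComm β α) _).symm

theorem swapOp_conjTranspose {α β : Type*} (X : Matrix (α × β) (α × β) ℂ) :
    swapOp Xᴴ = (swapOp X)ᴴ := rfl

theorem swapOp_one {α β : Type*} [DecidableEq α] [DecidableEq β] :
    swapOp (1 : Matrix (α × β) (α × β) ℂ) = 1 :=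
  Matrix.submatrix_one_equiv _

theorem swapOp_one_kronecker {α β : Type*} [DecidableEq α] (Z : Matrix β β ℂ) :
    swapOp ((1 : Matrix α α ℂ) ⊗ₖ Z) = Z ⊗ₖ (1 : Matrix α α ℂ) := by
  ext x y
  simp [swapOp, Prod.swap, mul_comm]

theorem posSemidef_swapOp_iff {α β : Type*} {X : Matrix (α × β) (α × β) ℂ} :
    (swapOp X).PosSemidef ↔ X.PosSemidef :=
  Matrix.posSemidef_submatrix_equiv _

theorem swapOp_mem_unitaryGroup {α β : Type*} [Fintype α] [DecidableEq α] [Fintype β]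
    [DecidableEq β] {X : Matrix (α × β) (α × β) ℂ} (hX : X ∈ Matrix.unitaryGroup _ ℂ) :
    swapOp X ∈ Matrix.unitaryGroup _ ℂ := by
  rw [Matrix.mem_unitaryGroup_iff, Matrix.star_eq_conjTranspose] at hX ⊢
  rw [← swapOp_conjTranspose, ← swapOp_mul, hX, swapOp_one]

theorem actLeft_flip {α β γ : Type*} [DecidableEq γ] (X : Matrix (α × β) (α × β) ℂ) :
    (actLeft γ X).submatrix (flipThree γ β α) (flipThree γ β α) = actRight γ (swapOp X) := by
  ext x y
  simp [actLeft, actRight, flipThree, swapOp, Prod.swap, Matrix.one_apply]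

theorem actRight_flip {α β γ : Type*} [DecidableEq α] (Y : Matrix (β × γ) (β × γ) ℂ) :
    (actRight α Y).submatrix (flipThree γ β α) (flipThree γ β α) = actLeft α (swapOp Y) := by
  ext x y
  simp [actLeft, actRight, flipThree, swapOp, Prod.swap, Matrix.one_apply]

/-- The operator of Bob in message `2 * j + 2`, on the event that he does not abort, with his
workspace as the left tensor factor. -/
def Scheme.bobOp (S : Scheme n 𝒜 ℳ ℬ) (j : ℕ) : Matrix (ℬ × ℳ) (ℬ × ℳ) ℂ :=
  swapOp (S.UB (2 * j + 2) * S.EB (2 * j + 1))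

/-- The operator of Alice's points on Bob's final workspace. -/
def Scheme.bobTerminal (S : Scheme n 𝒜 ℳ ℬ) (Λ : ℝ) : Matrix ℬ ℬ ℂ :=
  (Λ : ℂ) • S.PiB .one + ((Λ + 1 : ℝ) : ℂ) • S.PiB .zero

/-- The joint state of malicious Alice and honest Bob, with Bob's workspace as the left tensor
factor. -/
def Scheme.flippedState (S : Scheme n 𝒜 ℳ ℬ) {d : ℕ} (T : Strategy (Fin d × ℳ)) (i : ℕ) :
    Matrix (ℬ × ℳ × Fin d) (ℬ × ℳ × Fin d) ℂ :=
  (S.stateVsAlice T i).submatrix (flipThree ℬ ℳ (Fin d)) (flipThree ℬ ℳ (Fin d))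

theorem trace_submatrix_equiv {α β : Type*} [Fintype α] [Fintype β] (s : Matrix β β ℂ)
    (e : α ≃ β) : (s.submatrix e e).trace = s.trace :=
  e.sum_comp fun b => s b b

theorem submatrix_conj {α β : Type*} [Fintype α] [Fintype β] (e : α ≃ β) (X s : Matrix β β ℂ) :
    (X * s * Xᴴ).submatrix e e = X.submatrix e e * s.submatrix e e * (X.submatrix e e)ᴴ := by
  rw [← Matrix.submatrix_mul_equiv _ _ _ e, ← Matrix.submatrix_mul_equiv _ _ _ e]
  rfl

theorem Scheme.flippedState_zero (S : Scheme n 𝒜 ℳ ℬ) {d : ℕ} (T : Strategy (Fin d × ℳ)) :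
    S.flippedState T 0 = ketbra S.ψB ⊗ₖ swapOp T.init := by
  ext x y
  simp [Scheme.flippedState, Scheme.stateVsAlice, flipThree, swapOp, Prod.swap, mul_comm]

theorem Scheme.flippedState_odd (S : Scheme n 𝒜 ℳ ℬ) {d : ℕ} (T : Strategy (Fin d × ℳ)) (j : ℕ) :
    S.flippedState T (2 * j + 1) = ∑ k, actRight ℬ (swapOp (T.kraus (2 * j + 1) k)) *
      S.flippedState T (2 * j) * (actRight ℬ (swapOp (T.kraus (2 * j + 1) k)))ᴴ := by
  rw [Scheme.flippedState, Scheme.stateVsAlice, if_pos (odd_two_mul_add_one j)]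
  have hsum : ∀ f : Fin T.r → Matrix (Fin d × ℳ × ℬ) (Fin d × ℳ × ℬ) ℂ,
      (∑ k, f k).submatrix (flipThree ℬ ℳ (Fin d)) (flipThree ℬ ℳ (Fin d)) =
        ∑ k, (f k).submatrix (flipThree ℬ ℳ (Fin d)) (flipThree ℬ ℳ (Fin d)) := fun f => by
    ext x y
    simp [Matrix.sum_apply]
  rw [hsum]
  refine Finset.sum_congr rfl fun k _ => ?_
  rw [submatrix_conj, actLeft_flip]
  rfl

theorem Scheme.flippedState_even (S : Scheme n 𝒜 ℳ ℬ) {d : ℕ} (T : Strategy (Fin d × ℳ))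
    (j : ℕ) : S.flippedState T (2 * j + 2) = actLeft (Fin d) (S.bobOp j) *
      S.flippedState T (2 * j + 1) * (actLeft (Fin d) (S.bobOp j))ᴴ := by
  rw [Scheme.flippedState, Scheme.stateVsAlice,
    if_neg (Nat.not_odd_iff_even.2 ⟨j + 1, by ring⟩), submatrix_conj, actRight_flip]
  rfl

theorem Scheme.leftMarginal_flippedState_odd (S : Scheme n 𝒜 ℳ ℬ) {d : ℕ}
    (T : Strategy (Fin d × ℳ)) (j : ℕ) :
    leftMarginal (S.flippedState T (2 * j + 1)) = leftMarginal (S.flippedState T (2 * j)) := by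
  rw [Scheme.flippedState_odd]
  refine leftMarginal_channel _ ?_ _
  simp_rw [← swapOp_conjTranspose, ← swapOp_mul]
  rw [← swapOp_one, ← T.kraus_complete (2 * j + 1)]
  ext x y
  simp [swapOp, Matrix.sum_apply]

theorem Scheme.posSemidef_flippedState (S : Scheme n 𝒜 ℳ ℬ) {d : ℕ} (T : Strategy (Fin d × ℳ))
    (i : ℕ) : (S.flippedState T i).PosSemidef := by
  refine Matrix.PosSemidef.submatrix ?_ _
  induction i with
  | zero => exact (T.init_nonneg.kronecker (posSemidef_ketbra _)).submatrix _
  | succ i ih =>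
    rw [Scheme.stateVsAlice]
    split_ifs
    · exact Matrix.posSemidef_sum _ fun k _ => ih.mul_mul_conjTranspose_same _
    · exact ih.mul_mul_conjTranspose_same _

theorem Scheme.aliceReward_eq (S : Scheme n 𝒜 ℳ ℬ) (Λ : ℝ) {d : ℕ} (T : Strategy (Fin d × ℳ)) :
    S.aliceReward Λ T = (S.bobTerminal Λ * leftMarginal (S.flippedState T n)).trace.re := by
  have h : ∀ b, (((1 : Matrix (Fin d) (Fin d) ℂ) ⊗ₖ ((1 : Matrix ℳ ℳ ℂ) ⊗ₖ S.PiB b)) *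
      S.stateVsAlice T n).trace = (S.PiB b * leftMarginal (S.flippedState T n)).trace := by
    intro b
    rw [← trace_kronecker_one_mul, ← trace_submatrix_equiv _ (flipThree ℬ ℳ (Fin d)),
      ← Matrix.submatrix_mul_equiv _ _ _ (flipThree ℬ ℳ (Fin d))]
    congr 2
    ext x y
    simp [flipThree, Matrix.one_apply, Prod.ext_iff, ite_and]
  rw [Scheme.aliceReward, sum_outcome, Scheme.bobTerminal, re_trace_weighted_mul]
  simp only [alicePoints, h, zero_mul, add_zero]
  ring

/-- Bob acts second, so the chain samples after Alice's odd messages. For `n = 2 * k` its last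
member lies after a fictitious message `n + 1`; this is harmless, since only Bob's marginal counts
and Alice's channel preserves it. -/
theorem Scheme.isChain_flippedState (S : Scheme n 𝒜 ℳ ℬ) {d : ℕ} (T : Strategy (Fin d × ℳ))
    (k : ℕ) :
    IsChain k S.bobOp (ketbra S.ψB) fun j => dropRight (S.flippedState T (2 * j + 1)) := by
  refine IsChain.of_states (fun j => S.posSemidef_flippedState T _) ?_ fun j _ => ?_
  · rw [Scheme.leftMarginal_flippedState_odd, mul_zero, Scheme.flippedState_zero,
      leftMarginal_kronecker, swapOp, trace_submatrix_equiv, T.init_trace, one_smul]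
  · rw [Scheme.leftMarginal_flippedState_odd, ← Scheme.flippedState_even]
    rfl

theorem Scheme.exists_aliceReward_eq [Nonempty ℳ] (S : Scheme n 𝒜 ℳ ℬ) (Λ : ℝ)
    (hψ : star S.ψB ⬝ᵥ S.ψB = 1) {k : ℕ} (hn : n = 2 * k) {s : ℕ → Matrix (ℬ × ℳ) (ℬ × ℳ) ℂ}
    (hs : IsChain k S.bobOp (ketbra S.ψB) s) :
    (S.bobTerminal Λ * leftMarginal (s k)).trace.re ∈ S.aliceRewards Λ := by
  obtain ⟨d, η, V, φ, hη, hV, h0, hstep, hφ⟩ := hs.exists_realization hψ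
  -- Alice's preparation already produces the first member of the chain, so she does nothing in
  -- message `1`. Message `2 * j + 3` then follows Bob's action `j` and uses `V j`.
  let V' : ℕ → Matrix (Fin d × ℳ) (Fin d × ℳ) ℂ := fun i =>
    if i = 1 then 1 else swapOp (V ((i - 3) / 2))
  have hV' : ∀ i, V' i ∈ Matrix.unitaryGroup _ ℂ := fun i => by
    by_cases hi : i = 1
    · simp only [V', hi, if_true]
      exact one_mem _
    · simp only [V', hi, if_false]
      exact swapOp_mem_unitaryGroup (hV _)
  have hη' : star (η ∘ Equiv.prodComm (Fin d) ℳ) ⬝ᵥ (η ∘ Equiv.prodComm (Fin d) ℳ) = 1 := by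
    rw [← hη]
    exact Equiv.sum_comp (Equiv.prodComm (Fin d) ℳ) fun x => star (η x) * η x
  let T : Strategy (Fin d × ℳ) := .ofUnitaries _ hη' V' hV'
  have hodd : ∀ j, S.flippedState T (2 * j + 1) = actRight ℬ (swapOp (V' (2 * j + 1))) *
      S.flippedState T (2 * j) * (actRight ℬ (swapOp (V' (2 * j + 1))))ᴴ := fun j => by
    rw [Scheme.flippedState_odd]
    exact Fin.sum_univ_one _
  have hstate : ∀ j, j ≤ k → S.flippedState T (2 * j + 1) = ketbra (φ j) := by
    intro j
    induction j with
    | zero =>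
      intro _
      rw [hodd, mul_zero, Scheme.flippedState_zero, h0, ketbra_product]
      have h1 : actRight ℬ (swapOp (V' (0 + 1))) = 1 := by
        simp only [V', zero_add, if_true, swapOp_one]
        exact Matrix.one_kronecker_one
      rw [h1, one_mul, Matrix.conjTranspose_one, mul_one]
      rfl
    | succ j ih =>
      intro hj
      have hK : swapOp (V' (2 * (j + 1) + 1)) = V j := by
        simp only [V', show ¬ 2 * (j + 1) + 1 = 1 by omega, if_false,
          show (2 * (j + 1) + 1 - 3) / 2 = j by omega]
        rfl
      rw [hodd, hK, show 2 * (j + 1) = 2 * j + 2 by ring, Scheme.flippedState_even,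
        ih (by omega), hstep j hj, ketbra_mulVec, ketbra_mulVec]
  refine ⟨d, T, ?_⟩
  subst hn
  rw [S.aliceReward_eq, ← S.leftMarginal_flippedState_odd, hstate k le_rfl, ← hφ k le_rfl,
    leftMarginal_dropRight]

theorem Protocol.posSemidef_bob_step_iff (P : Protocol n 𝒜 ℳ ℬ) {j : ℕ} (hj : 2 * j + 1 < n)
    (Z Z' : Matrix ℬ ℬ ℂ) :
    (Z ⊗ₖ (1 : Matrix ℳ ℳ ℂ) -
      (P.bobOp j)ᴴ * (Z' ⊗ₖ (1 : Matrix ℳ ℳ ℂ)) * P.bobOp j).PosSemidef ↔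
    ((1 : Matrix ℳ ℳ ℂ) ⊗ₖ Z - P.EB (2 * j + 1) * (P.UB (2 * j + 2))ᴴ *
      ((1 : Matrix ℳ ℳ ℂ) ⊗ₖ Z') * P.UB (2 * j + 2) * P.EB (2 * j + 1)).PosSemidef := by
  have h : (P.EB (2 * j + 1))ᴴ = P.EB (2 * j + 1) :=
    (P.projB (2 * j + 1) hj (odd_two_mul_add_one j)).isSelfAdjoint
  rw [← posSemidef_swapOp_iff (X := (1 : Matrix ℳ ℳ ℂ) ⊗ₖ Z - _)]
  have hsub : ∀ X Y : Matrix (ℳ × ℬ) (ℳ × ℬ) ℂ, swapOp (X - Y) = swapOp X - swapOp Y :=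
    fun X Y => rfl
  rw [hsub, swapOp_mul, swapOp_mul, swapOp_mul, swapOp_mul, swapOp_one_kronecker,
    swapOp_one_kronecker, Scheme.bobOp, swapOp_mul, Matrix.conjTranspose_mul,
    ← swapOp_conjTranspose (P.EB _), h, swapOp_conjTranspose]
  simp only [mul_assoc]

theorem Protocol.isDualChain_of_dualB (P : Protocol n 𝒜 ℳ ℬ) {Λ : ℝ} {k : ℕ} (hn : n = 2 * k)
    {Z : ℕ → Matrix ℬ ℬ ℂ} (hZ : P.DualB Λ Z) :
    IsDualChain k P.bobOp (P.bobTerminal Λ) fun j => Z (2 * j) where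
  posSemidef j hj := hZ.nonneg _ (by omega)
  step j hj := by
    rw [P.posSemidef_bob_step_iff (by omega), hZ.keep (2 * j) (by omega) (odd_two_mul_add_one j)]
    exact hZ.step (2 * j + 1) (by omega) ⟨j + 1, by ring⟩
  terminal := by rw [← hn]; exact hZ.terminal

/-- Here rounding down is right: the equalities pair index `2 * j` with `2 * j + 1`. -/
theorem Protocol.dualB_of_isDualChain (P : Protocol n 𝒜 ℳ ℬ) {Λ : ℝ} {k : ℕ} (hn : n = 2 * k)
    {Z : ℕ → Matrix ℬ ℬ ℂ} (hZ : IsDualChain k P.bobOp (P.bobTerminal Λ) Z) :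
    P.DualB Λ fun i => Z (i / 2) where
  nonneg i hi := hZ.posSemidef _ (by omega)
  step i hi heven := by
    obtain ⟨j, rfl⟩ : ∃ j, i = 2 * j + 1 := by
      obtain ⟨j, hj⟩ := heven
      exact ⟨j - 1, by omega⟩
    rw [show (2 * j + 1) / 2 = j by omega, show (2 * j + 1 + 1) / 2 = j + 1 by omega]
    exact (P.posSemidef_bob_step_iff hi _ _).1 (hZ.step j (by omega))
  keep i hi hodd := by
    obtain ⟨j, hj⟩ := hodd
    congr 1
    omega
  terminal := by
    rw [show n / 2 = k by omega]
    exact hZ.terminal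

theorem Protocol.alice_optimum (P : Protocol n 𝒜 ℳ ℬ) {Λ : ℝ} (hΛ : 0 ≤ Λ) :
    IsGreatest (P.aliceRewards Λ) (P.RA Λ) ∧
      IsGLB {x : ℝ | ∃ Z, P.DualB Λ Z ∧ x = expect (Z 0) P.ψB} (P.RA Λ) := by
  have := P.nonempty_message
  obtain ⟨k, hk⟩ := P.n_even
  have hn : n = 2 * k := by omega
  refine isGreatest_and_isGLB_of_chains (k := k) (W := P.bobOp) (T := P.bobTerminal Λ)
    (posSemidef_weighted hΛ (by linarith) (P.povmB_nonneg _) (P.povmB_nonneg _)) ?_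
    (fun s hs => P.exists_aliceReward_eq Λ P.norm_ψB hn hs)
    (fun Z hZ => ⟨_, P.isDualChain_of_dualB hn hZ, rfl⟩)
    (fun Z hZ => ⟨_, P.dualB_of_isDualChain hn hZ, rfl⟩)
  rintro _ ⟨d, T, rfl⟩
  refine ⟨_, P.isChain_flippedState T k, ?_⟩
  rw [P.aliceReward_eq, leftMarginal_dropRight, P.leftMarginal_flippedState_odd, ← hn]

end MaliciousAlice

/-! ### Dual feasible points -/

section EigenvalueForm

theorem posSemidef_kronecker_one_sub_of_le {A A' : Matrix 𝒜 𝒜 ℂ} {X : Matrix (𝒜 × ℳ) (𝒜 × ℳ) ℂ}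
    (hA : (A' - A).PosSemidef) (h : (A ⊗ₖ (1 : Matrix ℳ ℳ ℂ) - X).PosSemidef) :
    (A' ⊗ₖ (1 : Matrix ℳ ℳ ℂ) - X).PosSemidef := by
  have := h.add (hA.kronecker (Matrix.PosSemidef.one (n := ℳ)))
  convert this using 1
  ext x y
  simp [sub_mul]

theorem posSemidef_one_kronecker_sub_of_le {A A' : Matrix ℬ ℬ ℂ} {X : Matrix (ℳ × ℬ) (ℳ × ℬ) ℂ}
    (hA : (A' - A).PosSemidef) (h : ((1 : Matrix ℳ ℳ ℂ) ⊗ₖ A - X).PosSemidef) :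
    ((1 : Matrix ℳ ℳ ℂ) ⊗ₖ A' - X).PosSemidef := by
  have := h.add ((Matrix.PosSemidef.one (n := ℳ)).kronecker hA)
  convert this using 1
  ext x y
  simp [mul_sub]

/-- `Z 0` enters only on the larger side of the first step; the equalities start at index `1`, and
`n > 0` protects the terminal condition. -/
theorem Protocol.dualA_update_perturb (P : Protocol n 𝒜 ℳ ℬ) {Λ : ℝ} {Z : ℕ → Matrix 𝒜 𝒜 ℂ}
    (hZ : P.DualA Λ Z) {ε : ℝ} (hε : 0 < ε) :
    P.DualA Λ (Function.update Z 0 (perturb (Z 0) P.ψA ε)) where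
  nonneg i hi := by
    rcases eq_or_ne i 0 with rfl | h0
    · rw [Function.update_self]
      exact posSemidef_perturb (hZ.nonneg 0 hi) P.norm_ψA hε
    · rw [Function.update_of_ne h0]
      exact hZ.nonneg i hi
  step i hi hodd := by
    rw [Function.update_of_ne (Nat.succ_ne_zero i)]
    rcases eq_or_ne i 0 with rfl | h0
    · rw [Function.update_self]
      exact posSemidef_kronecker_one_sub_of_le
        (posSemidef_perturb_sub (hZ.nonneg 0 (Nat.zero_le n)).1 P.norm_ψA hε) (hZ.step 0 hi hodd)
    · rw [Function.update_of_ne h0]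
      exact hZ.step i hi hodd
  keep i hi heven := by
    have h0 : i ≠ 0 := by
      rintro rfl
      simp at heven
    rw [Function.update_of_ne (Nat.succ_ne_zero i), Function.update_of_ne h0]
    exact hZ.keep i hi heven
  terminal := by
    rw [Function.update_of_ne P.n_pos.ne']
    exact hZ.terminal

/-- The constraint `Z 0 = Z 1` forces both to change together. Since `n` is even and positive, index
`1` is not terminal. -/
theorem Protocol.dualB_update_perturb (P : Protocol n 𝒜 ℳ ℬ) {Λ : ℝ} {Z : ℕ → Matrix ℬ ℬ ℂ}
    (hZ : P.DualB Λ Z) {ε : ℝ} (hε : 0 < ε) :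
    P.DualB Λ (Function.update (Function.update Z 0 (perturb (Z 0) P.ψB ε)) 1
      (perturb (Z 0) P.ψB ε)) := by
  obtain ⟨k, hk⟩ := P.n_even
  have hn := P.n_pos
  set Z' := perturb (Z 0) P.ψB ε with hZ'
  have hle := posSemidef_perturb_sub (hZ.nonneg 0 (Nat.zero_le n)).1 P.norm_ψB hε
  have hlow : ∀ i, i ≤ 1 → Function.update (Function.update Z 0 Z') 1 Z' i = Z' := by
    intro i hi
    interval_cases i <;> simp
  have hhigh : ∀ i, 1 < i → Function.update (Function.update Z 0 Z') 1 Z' i = Z i := by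
    intro i hi
    rw [Function.update_of_ne (by omega), Function.update_of_ne (by omega)]
  refine ⟨fun i hi => ?_, fun i hi heven => ?_, fun i hi hodd => ?_, ?_⟩
  · rcases le_or_gt i 1 with h | h
    · rw [hlow i h]
      exact posSemidef_perturb (hZ.nonneg 0 (Nat.zero_le n)) P.norm_ψB hε
    · rw [hhigh i h]
      exact hZ.nonneg i hi
  · have hi1 : 1 ≤ i := by
      obtain ⟨j, hj⟩ := heven
      omega
    rw [hhigh (i + 1) (by omega)]
    rcases hi1.eq_or_lt with rfl | h
    · rw [hlow 1 le_rfl]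
      refine posSemidef_one_kronecker_sub_of_le ?_ (hZ.step 1 hi heven)
      rw [← hZ.keep 0 hn odd_one]
      exact hle
    · rw [hhigh i h]
      exact hZ.step i hi heven
  · rcases Nat.eq_zero_or_pos i with rfl | h
    · rw [hlow 0 zero_le_one, hlow (0 + 1) le_rfl]
    · have h2 : 1 < i := by
        obtain ⟨j, hj⟩ := hodd
        omega
      rw [hhigh i h2, hhigh (i + 1) (by omega)]
      exact hZ.keep i hi hodd
  · rw [hhigh n (by omega)]
    exact hZ.terminal

theorem expect_of_eigenvector {ι : Type*} [Fintype ι] [DecidableEq ι] {Z : Matrix ι ι ℂ}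
    {ψ : ι → ℂ} (hψ : star ψ ⬝ᵥ ψ = 1) {c : ℝ} (h : Z *ᵥ ψ = (c : ℂ) • ψ) : expect Z ψ = c := by
  rw [expect_eq, h, dotProduct_smul, hψ, smul_eq_mul, mul_one, Complex.ofReal_re]

theorem expect_nonneg {ι : Type*} [Fintype ι] [DecidableEq ι] {Z : Matrix ι ι ℂ}
    (hZ : Z.PosSemidef) (ψ : ι → ℂ) : 0 ≤ expect Z ψ :=
  re_trace_mul_nonneg hZ (posSemidef_ketbra ψ)

theorem Protocol.dualFeasiblePoint_perturb (P : Protocol n 𝒜 ℳ ℬ) {Λ : ℝ}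
    {ZA : ℕ → Matrix 𝒜 𝒜 ℂ} {ZB : ℕ → Matrix ℬ ℬ ℂ} (hA : P.DualA Λ ZA) (hB : P.DualB Λ ZB)
    {ε : ℝ} (hε : 0 < ε) :
    P.DualFeasiblePoint Λ (Function.update ZA 0 (perturb (ZA 0) P.ψA ε))
      (Function.update (Function.update ZB 0 (perturb (ZB 0) P.ψB ε)) 1 (perturb (ZB 0) P.ψB ε))
      (expect (ZA 0) P.ψA + ε) (expect (ZB 0) P.ψB + ε) where
  dualA := P.dualA_update_perturb hA hε
  dualB := P.dualB_update_perturb hB hε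
  β_pos := add_pos_of_nonneg_of_pos (expect_nonneg (hA.nonneg 0 (Nat.zero_le n)) _) hε
  α_pos := add_pos_of_nonneg_of_pos (expect_nonneg (hB.nonneg 0 (Nat.zero_le n)) _) hε
  eigA := by
    rw [Function.update_self]
    exact perturb_mulVec_self P.norm_ψA _ _
  eigB := by
    rw [Function.update_of_ne zero_ne_one, Function.update_self]
    exact perturb_mulVec_self P.norm_ψB _ _

end EigenvalueForm

end PenWCF

end

theorem mainTheorem7 {n : ℕ} {𝒜 ℳ ℬ : Type*} [Fintype 𝒜] [DecidableEq 𝒜] [Fintype ℳ]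
    [DecidableEq ℳ] [Fintype ℬ] [DecidableEq ℬ] (P : PenWCF.Protocol n 𝒜 ℳ ℬ)
    (Λ : ℝ) (hΛ : 0 ≤ Λ) :
    -- the cheating rewards are maxima over all cheating strategies
    IsGreatest (P.bobRewards Λ) (P.RB Λ) ∧
    IsGreatest (P.aliceRewards Λ) (P.RA Λ) ∧
    -- they are the values of the dual programs
    IsGLB {x : ℝ | ∃ Z, P.DualA Λ Z ∧ x = PenWCF.expect (Z 0) P.ψA} (P.RB Λ) ∧
    IsGLB {x : ℝ | ∃ Z, P.DualB Λ Z ∧ x = PenWCF.expect (Z 0) P.ψB} (P.RA Λ) ∧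
    -- they are the infima of the eigenvalues over dual feasible points
    IsGLB {β : ℝ | ∃ ZA ZB α, P.DualFeasiblePoint Λ ZA ZB β α} (P.RB Λ) ∧
    IsGLB {α : ℝ | ∃ ZA ZB β, P.DualFeasiblePoint Λ ZA ZB β α} (P.RA Λ) ∧
    -- the perturbation that makes the initial local state an eigenvector
    (∀ Z, P.DualA Λ Z → ∀ ε : ℝ, 0 < ε →
      (PenWCF.perturb (Z 0) P.ψA ε - Z 0).PosSemidef ∧
      PenWCF.perturb (Z 0) P.ψA ε *ᵥ P.ψA =
        ((PenWCF.expect (Z 0) P.ψA + ε : ℝ) : ℂ) • P.ψA ∧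
      P.DualA Λ (Function.update Z 0 (PenWCF.perturb (Z 0) P.ψA ε))) ∧
    (∀ Z, P.DualB Λ Z → ∀ ε : ℝ, 0 < ε →
      (PenWCF.perturb (Z 0) P.ψB ε - Z 0).PosSemidef ∧
      PenWCF.perturb (Z 0) P.ψB ε *ᵥ P.ψB =
        ((PenWCF.expect (Z 0) P.ψB + ε : ℝ) : ℂ) • P.ψB ∧
      P.DualB Λ (Function.update (Function.update Z 0 (PenWCF.perturb (Z 0) P.ψB ε)) 1
        (PenWCF.perturb (Z 0) P.ψB ε))) := by
  obtain ⟨hB, hA'⟩ := P.bob_optimum hΛ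
  obtain ⟨hA, hB'⟩ := P.alice_optimum hΛ
  refine ⟨hB, hA, hA', hB', ⟨?_, fun w hw => ?_⟩, ⟨?_, fun w hw => ?_⟩, fun Z hZ ε hε => ?_,
    fun Z hZ ε hε => ?_⟩
  · rintro β ⟨ZA, ZB, α, h⟩
    exact hA'.1 ⟨ZA, h.dualA, (PenWCF.expect_of_eigenvector P.norm_ψA h.eigA).symm⟩
  -- A dual feasible point needs operators for both parties. The other dual program is feasible
  -- because an empty set of reals has no greatest lower bound; then `ε → 0`.
  · obtain ⟨_, ZB, hZB, -⟩ := hB'.nonempty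
    refine hA'.2 ?_
    rintro _ ⟨ZA, hZA, rfl⟩
    exact le_of_forall_pos_le_add fun ε hε =>
      hw ⟨_, _, _, P.dualFeasiblePoint_perturb hZA hZB hε⟩
  · rintro α ⟨ZA, ZB, β, h⟩
    exact hB'.1 ⟨ZB, h.dualB, (PenWCF.expect_of_eigenvector P.norm_ψB h.eigB).symm⟩
  · obtain ⟨_, ZA, hZA, -⟩ := hA'.nonempty
    refine hB'.2 ?_
    rintro _ ⟨ZB, hZB, rfl⟩
    exact le_of_forall_pos_le_add fun ε hε =>
      hw ⟨_, _, _, P.dualFeasiblePoint_perturb hZA hZB hε⟩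
  · exact ⟨PenWCF.posSemidef_perturb_sub (hZ.nonneg 0 (Nat.zero_le n)).1 P.norm_ψA hε,
      PenWCF.perturb_mulVec_self P.norm_ψA _ _, P.dualA_update_perturb hZ hε⟩
  · exact ⟨PenWCF.posSemidef_perturb_sub (hZ.nonneg 0 (Nat.zero_le n)).1 P.norm_ψB hε,
      PenWCF.perturb_mulVec_self P.norm_ψB _ _, P.dualB_update_perturb hZ hε⟩
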